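/- **Theorem 1 (Perturbation Formula).** Let $N\ge 1$, let $X$ be an arbitrary $N\times N$ complex matrix and let $\varepsilon>0$. Let $A$ and $B$ be random $N\times N$ matrices all of whose $2N^2$ entries are independent standard complex Gaussian random variables (law with density $\frac1\pi e^{-|z|^2}$ on $\mathbb{C}$). Represent the quaternion $q=a+bj$ ($a,b\in\mathbb{C}$) by the matrix $\boldsymbol q=\begin{pmatrix} a & ib\\ i\bar b & \bar a\end{pmatrix}$, and let $\boldsymbol X$ be the $2N\times 2N$ matrix composed of the $2\times2$ blocks $\boldsymbol X_{ij}=\begin{pmatrix} X_{ij} & 0\\ 0 & \overline{X_{ji}}\end{pmatrix}$. For $q=\lambda+\varepsilon j$, the quaternionic Green's function $\mathcal G(q;X)$ is the quaternion whose matrix is $\frac1N\sum_{i=1}^N\mathcal R_{ii}$, where $\mathcal R=(\boldsymbol X-\boldsymbol q)^{-1}$, $\boldsymbol q$ acting as the matrix with all diagonal blocks equal to $\boldsymbol q$ and all other blocks zero, and $\mathcal R_{ii}$ being the diagonal $2\times 2$ blocks of $\mathcal R$. Then $\lambda\mapsto\mathcal G(\lambda+\varepsilon j;X)$ is continuously differentiable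 in the real sense; put $$\varrho_\varepsilon(\lambda;X)=-\frac1\pi\,\mathrm{Re}\,\frac{\partial}{\partial\bar\lambda}\,\mathcal G(\lambda+\varepsilon j;X).$$ Then $B$ is almost surely invertible, and the mean spectral density of $X+\varepsilon AB^{-1}$ is $\varrho_\varepsilon(\,\cdot\,;X)$, $$\mathbb E\,\varrho(\lambda;X+\varepsilon AB^{-1})=\varrho_\varepsilon(\lambda;X),$$ as an identity of generalised functions of $\lambda\in\mathbb C$, where $\varrho(\lambda;M)=\frac1N\sum_i\delta(\lambda_i^{(M)}-\lambda)$ and the $\lambda_i^{(M)}$ are the eigenvalues of $M$ with algebraic multiplicity. That is, for every smooth compactly supported $\varphi:\mathbb C\to\mathbb R$, the random variable $\frac1N\sum_i\varphi\big(\lambda_i^{(X+\varepsilon AB^{-1})}\big)$ is integrable and $$\mathbb E\,\frac1N\sum_{i=1}^N\varphi\big(\lambda_i^{(X+\varepsilon AB^{-1})}\big)=\int_{\mathbb C}\varphi(\lambda)\,\varrho_\varepsilon(\lambda;X)\,d^2\lambda .$$ -/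

import Mathlib

open MeasureTheory ProbabilityTheory
open scoped Matrix Quaternion ContDiff Kronecker ENNReal

noncomputable section

namespace QuatGreen

/-- The quaternion `a + b j` built from two complex numbers `a`, `b`. -/
def quat (a b : ℂ) : ℍ[ℝ] := ⟨a.re, a.im, b.re, b.im⟩

/-- The `2 × 2` complex matrix representation of a quaternion `q = a + b j`, where
`a = q.re + q.imI i` and `b = q.imJ + q.imK i`. -/
def quatMatrix (q : ℍ[ℝ]) : Matrix (Fin 2) (Fin 2) ℂ :=
  let a : ℂ := ⟨q.re, q.imI⟩
  let b : ℂ := ⟨q.imJ, q.imK⟩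
  !![a, Complex.I * b; Complex.I * star b, star a]

/-- The `2N × 2N` matrix, made of `2 × 2` blocks, whose block `(i, j)` is
`diag (X i j, conj (X j i))`. -/
def double {N : ℕ} (X : Matrix (Fin N) (Fin N) ℂ) :
    Matrix (Fin N × Fin 2) (Fin N × Fin 2) ℂ :=
  Matrix.of fun p r => (!![X p.1 r.1, 0; 0, star (X r.1 p.1)] : Matrix (Fin 2) (Fin 2) ℂ) p.2 r.2

/-- The doubled matrix of `X` minus the quaternion `q`, the latter acting as the `2N × 2N` matrix
all of whose diagonal `2 × 2` blocks are the matrix of `q`. -/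
def shifted {N : ℕ} (q : ℍ[ℝ]) (X : Matrix (Fin N) (Fin N) ℂ) :
    Matrix (Fin N × Fin 2) (Fin N × Fin 2) ℂ :=
  double X - (1 : Matrix (Fin N) (Fin N) ℂ) ⊗ₖ quatMatrix q

/-- The resolvent: the inverse of the shifted doubled matrix. -/
def resolvent {N : ℕ} (q : ℍ[ℝ]) (X : Matrix (Fin N) (Fin N) ℂ) :
    Matrix (Fin N × Fin 2) (Fin N × Fin 2) ℂ :=
  (shifted q X)⁻¹

/-- The normalised sum of the diagonal `2 × 2` blocks of the resolvent. -/
def blockMean {N : ℕ} (q : ℍ[ℝ]) (X : Matrix (Fin N) (Fin N) ℂ) :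
    Matrix (Fin 2) (Fin 2) ℂ :=
  Matrix.of fun s t => (1 / (N : ℂ)) * ∑ i : Fin N, resolvent q X (i, s) (i, t)

/-- The quaternionic Green's function of `X` at `q`: the quaternion `a + b j` read off from the
first row `(a, i b)` of `blockMean q X`.  That its matrix is the whole of `blockMean q X` is
`quatMatrix_green` below. -/
def green {N : ℕ} (q : ℍ[ℝ]) (X : Matrix (Fin N) (Fin N) ℂ) : ℍ[ℝ] :=
  quat (blockMean q X 0 0) (-Complex.I * blockMean q X 0 1)

/-- The anti-holomorphic derivative `∂/∂z̄ = (∂/∂x + i ∂/∂y) / 2` of a quaternion-valued function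
of a complex variable. -/
def dbar (F : ℂ → ℍ[ℝ]) (z : ℂ) : ℍ[ℝ] :=
  (1 / 2 : ℝ) • (fderiv ℝ F z 1 + quat Complex.I 0 * fderiv ℝ F z Complex.I)

/-- The regularised spectral density of `X`:
`-(1/π) Re ∂/∂z̄ 𝒢(z + ε j; X)`. -/
def regDensity {N : ℕ} (ε : ℝ) (X : Matrix (Fin N) (Fin N) ℂ) (z : ℂ) : ℝ :=
  -(1 / Real.pi) * (dbar (fun w : ℂ => green (quat w (ε : ℂ)) X) z).re

/-- The spectral density `(1/N) ∑ δ(λᵢ - ·)` of a matrix as a generalised function, that is, its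
value at a test function `φ`.  Eigenvalues are counted with algebraic multiplicity. -/
def spectralDensity {N : ℕ} (M : Matrix (Fin N) (Fin N) ℂ) (φ : ℂ → ℝ) : ℝ :=
  (1 / (N : ℝ)) * (M.charpoly.roots.map φ).sum

/-- The standard complex Gaussian law, with density `exp (-|z|²) / π`. -/
def stdComplexGaussian : Measure ℂ :=
  volume.withDensity fun z => ENNReal.ofReal (1 / Real.pi * Real.exp (-‖z‖ ^ 2))

theorem quatMatrix_quat (a b : ℂ) :
    quatMatrix (quat a b) = !![a, Complex.I * b; Complex.I * star b, star a] := rfl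

theorem shifted_blocks {N : ℕ} (X : Matrix (Fin N) (Fin N) ℂ) (z : ℂ) (ε : ℝ) (i j : Fin N) :
    shifted (quat z (ε : ℂ)) X (i, 0) (j, 0) = (X - z • 1) i j ∧
    shifted (quat z (ε : ℂ)) X (i, 0) (j, 1) = -(Complex.I * ε) * (1 : Matrix _ _ ℂ) i j ∧
    shifted (quat z (ε : ℂ)) X (i, 1) (j, 0) = -(Complex.I * ε) * (1 : Matrix _ _ ℂ) i j ∧
    shifted (quat z (ε : ℂ)) X (i, 1) (j, 1) = (X - z • 1)ᴴ i j := by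
  by_cases h : i = j
  · subst h
    simp [shifted, double, quatMatrix_quat]
  · simp [shifted, double, quatMatrix_quat, h, Ne.symm h]

/-- For `ε ≠ 0` the resolvent at `z + ε j` is a genuine inverse. -/
theorem isUnit_shifted {N : ℕ} (X : Matrix (Fin N) (Fin N) ℂ) (z : ℂ) {ε : ℝ} (hε : ε ≠ 0) :
    IsUnit (shifted (quat z (ε : ℂ)) X) := by
  rw [← Matrix.mulVec_injective_iff_isUnit, ← Matrix.coe_mulVecLin, injective_iff_map_eq_zero]
  intro v hv
  rw [Matrix.mulVecLin_apply] at hv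
  set Y := X - z • (1 : Matrix (Fin N) (Fin N) ℂ) with hY
  have e0 : ∀ i, ∑ j, Y i j * v (j, 0) = Complex.I * ε * v (i, 1) := by
    intro i
    have := congrFun hv (i, 0)
    simp only [Matrix.mulVec, dotProduct, Fintype.sum_prod_type, Fin.sum_univ_two,
      (shifted_blocks X z ε _ _).1, (shifted_blocks X z ε _ _).2.1, Finset.sum_add_distrib,
      Matrix.one_apply] at this
    rw [← hY] at this
    simp at this
    linear_combination this
  have e1 : ∀ j, ∑ i, star (v (i, 1)) * Y i j = -(Complex.I * ε * star (v (j, 0))) := by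
    intro j
    have := congrFun hv (j, 1)
    simp only [Matrix.mulVec, dotProduct, Fintype.sum_prod_type, Fin.sum_univ_two,
      (shifted_blocks X z ε _ _).2.2.1, (shifted_blocks X z ε _ _).2.2.2, Finset.sum_add_distrib,
      Matrix.one_apply, ← hY, Matrix.conjTranspose_apply] at this
    have h2 := congrArg star this
    simp [-RCLike.star_def] at h2
    simp at h2 ⊢
    simp only [mul_comm] at h2 ⊢
    linear_combination h2
  have key : Complex.I * ε * ∑ i, (star (v (i, 1)) * v (i, 1) + star (v (i, 0)) * v (i, 0)) = 0 := by
    have h1 : ∑ i, star (v (i, 1)) * ∑ j, Y i j * v (j, 0)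
        = ∑ j, (∑ i, star (v (i, 1)) * Y i j) * v (j, 0) := by
      simp only [Finset.mul_sum, Finset.sum_mul]
      rw [Finset.sum_comm]
      simp only [mul_assoc]
    simp only [e0, e1] at h1
    rw [Finset.sum_add_distrib, mul_add, Finset.mul_sum, Finset.mul_sum]
    have h3 : ∀ f g : Fin N → ℂ, ∑ i, f i = ∑ i, -g i → ∑ i, f i + ∑ i, g i = 0 := by
      intro f g h
      rw [h, Finset.sum_neg_distrib]; ring
    apply h3
    convert h1 using 2 <;> ring
  have hs : ∑ i, (‖v (i, 1)‖ ^ 2 + ‖v (i, 0)‖ ^ 2) = 0 := by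
    have h0 : Complex.I * (ε : ℂ) ≠ 0 := by simp [hε]
    have := (mul_eq_zero.mp key).resolve_left h0
    have hc : ∀ w : ℂ, star w * w = ((‖w‖ ^ 2 : ℝ) : ℂ) := by
      intro w
      simpa using Complex.conj_mul' w
    simp only [hc] at this
    exact_mod_cast this
  rw [Finset.sum_eq_zero_iff_of_nonneg (fun _ _ => by positivity)] at hs
  ext ⟨i, s⟩
  have h := hs i (Finset.mem_univ _)
  have h1 : ‖v (i, 1)‖ = 0 := by nlinarith [sq_nonneg ‖v (i, 1)‖, sq_nonneg ‖v (i, 0)‖]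
  have h0 : ‖v (i, 0)‖ = 0 := by nlinarith [sq_nonneg ‖v (i, 1)‖, sq_nonneg ‖v (i, 0)‖]
  fin_cases s
  · simpa using h0
  · simpa using h1

/-- For `ε ≠ 0` the matrix representation of the Green's function at `z + ε j` is the normalised
sum of the diagonal blocks of the resolvent. -/
theorem quatMatrix_green {N : ℕ} (X : Matrix (Fin N) (Fin N) ℂ) (z : ℂ) {ε : ℝ} (hε : ε ≠ 0) :
    quatMatrix (green (quat z (ε : ℂ)) X) = blockMean (quat z (ε : ℂ)) X := by
  have hU := isUnit_shifted X z hε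
  have hdet := (Matrix.isUnit_iff_isUnit_det _).mp hU
  set Y := X - z • (1 : Matrix (Fin N) (Fin N) ℂ) with hY
  obtain ⟨t, ht⟩ : ∃ t : ℂ, t = Complex.I * ε := ⟨_, rfl⟩
  have ht0 : t ≠ 0 := by simp [ht, hε]
  have hts : star t = -t := by simp [ht]
  set M := shifted (quat z (ε : ℂ)) X with hM
  set R := resolvent (quat z (ε : ℂ)) X with hR
  have hMR : M * R = 1 := Matrix.mul_nonsing_inv _ hdet
  have hRM : R * M = 1 := Matrix.nonsing_inv_mul _ hdet
  let blk : Fin 2 → Fin 2 → Matrix (Fin N) (Fin N) ℂ := fun s u => Matrix.of fun i j => R (i, s) (j, u)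
  have hMR' : ∀ s u, (Matrix.of fun i j => (M * R) (i, s) (j, u))
      = (Matrix.of fun i j => M (i, s) (j, 0)) * blk 0 u
        + (Matrix.of fun i j => M (i, s) (j, 1)) * blk 1 u := by
    intro s u
    ext i j
    simp [blk, Matrix.mul_apply, Fintype.sum_prod_type, Finset.sum_add_distrib]
  have hRM' : ∀ s u, (Matrix.of fun i j => (R * M) (i, s) (j, u))
      = blk s 0 * (Matrix.of fun i j => M (i, 0) (j, u))
        + blk s 1 * (Matrix.of fun i j => M (i, 1) (j, u)) := by
    intro s u
    ext i j
    simp [blk, Matrix.mul_apply, Fintype.sum_prod_type, Finset.sum_add_distrib]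
  have m00 : (Matrix.of fun i j => M (i, 0) (j, 0)) = Y := by
    ext i j; exact (shifted_blocks X z ε i j).1
  have m01 : (Matrix.of fun i j => M (i, 0) (j, 1)) = -t • (1 : Matrix (Fin N) (Fin N) ℂ) := by
    ext i j; rw [ht]; exact (shifted_blocks X z ε i j).2.1
  have m10 : (Matrix.of fun i j => M (i, 1) (j, 0)) = -t • (1 : Matrix (Fin N) (Fin N) ℂ) := by
    ext i j; rw [ht]; exact (shifted_blocks X z ε i j).2.2.1
  have m11 : (Matrix.of fun i j => M (i, 1) (j, 1)) = Yᴴ := by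
    ext i j; exact (shifted_blocks X z ε i j).2.2.2
  have one_s : ∀ s, (Matrix.of fun i j => (1 : Matrix (Fin N × Fin 2) (Fin N × Fin 2) ℂ) (i, s) (j, s))
      = (1 : Matrix (Fin N) (Fin N) ℂ) := by
    intro s; ext i j; simp [Matrix.one_apply]
  have one_su : ∀ s u, s ≠ u →
      (Matrix.of fun i j => (1 : Matrix (Fin N × Fin 2) (Fin N × Fin 2) ℂ) (i, s) (j, u))
      = (0 : Matrix (Fin N) (Fin N) ℂ) := by
    intro s u h; ext i j; simp [h]
  have a1 := hMR' 0 0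
  have a4 := hMR' 1 1
  have b1 := hRM' 0 0
  have b2 := hRM' 0 1
  have b3 := hRM' 1 0
  have b4 := hRM' 1 1
  rw [hMR, one_s] at a1 a4
  rw [hRM, one_s] at b1 b4
  rw [hRM, one_su _ _ (by decide)] at b2 b3
  simp only [m00, m01, m10, m11] at a1 a4 b1 b2 b3 b4
  -- the conjugate-transposed solution
  let R' : Matrix (Fin N × Fin 2) (Fin N × Fin 2) ℂ := Matrix.of fun p r =>
    (!![(blk 1 1)ᴴ p.1 r.1, -(blk 0 1)ᴴ p.1 r.1; -(blk 1 0)ᴴ p.1 r.1, (blk 0 0)ᴴ p.1 r.1] :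
      Matrix (Fin 2) (Fin 2) ℂ) p.2 r.2
  have c1 := congrArg Matrix.conjTranspose b1
  have c2 := congrArg Matrix.conjTranspose b2
  have c3 := congrArg Matrix.conjTranspose b3
  have c4 := congrArg Matrix.conjTranspose b4
  simp [-RCLike.star_def, hts] at c1 c2 c3 c4
  have hMR2 : M * R' = 1 := by
    have hx : ∀ (s u : Fin 2) (i j : Fin N), (M * R') (i, s) (j, u)
      = ((Matrix.of fun i j => M (i, s) (j, 0)) * (Matrix.of fun i j => R' (i, 0) (j, u))
        + (Matrix.of fun i j => M (i, s) (j, 1)) * (Matrix.of fun i j => R' (i, 1) (j, u))) i j := by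
      intro s u i j
      simp [Matrix.mul_apply, Fintype.sum_prod_type, Finset.sum_add_distrib]
    have r00 : (Matrix.of fun i j => R' (i, 0) (j, 0)) = (blk 1 1)ᴴ := rfl
    have r01 : (Matrix.of fun i j => R' (i, 0) (j, 1)) = -(blk 0 1)ᴴ := rfl
    have r10 : (Matrix.of fun i j => R' (i, 1) (j, 0)) = -(blk 1 0)ᴴ := rfl
    have r11 : (Matrix.of fun i j => R' (i, 1) (j, 1)) = (blk 0 0)ᴴ := rfl
    ext ⟨i, s⟩ ⟨j, u⟩
    rw [hx]
    fin_cases s <;> fin_cases u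
    · simp only [Fin.zero_eta, Fin.mk_one, m00, m01, r00, r10]
      have : Y * (blk 1 1)ᴴ + -t • (1 : Matrix (Fin N) (Fin N) ℂ) * -(blk 1 0)ᴴ = 1 := by
        refine Eq.trans ?_ c4.symm; simp; abel
      rw [this]; simp [Matrix.one_apply]
    · simp only [Fin.zero_eta, Fin.mk_one, m00, m01, r01, r11]
      have : Y * -(blk 0 1)ᴴ + -t • (1 : Matrix (Fin N) (Fin N) ℂ) * (blk 0 0)ᴴ = 0 := by
        rw [← neg_eq_zero]; simp [c2]
      rw [this]; simp [Matrix.one_apply]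
    · simp only [Fin.zero_eta, Fin.mk_one, m10, m11, r00, r10]
      have : -t • (1 : Matrix (Fin N) (Fin N) ℂ) * (blk 1 1)ᴴ + Yᴴ * -(blk 1 0)ᴴ = 0 := by
        rw [← neg_eq_zero]; simp [c3]
      rw [this]; simp [Matrix.one_apply]
    · simp only [Fin.zero_eta, Fin.mk_one, m10, m11, r01, r11]
      have : -t • (1 : Matrix (Fin N) (Fin N) ℂ) * -(blk 0 1)ᴴ + Yᴴ * (blk 0 0)ᴴ = 1 := by
        refine Eq.trans ?_ c1.symm; simp; abel
      rw [this]; simp [Matrix.one_apply]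
  have hRR : R' = R := by
    have := congrArg (fun K => R * K) hMR2
    simpa [← mul_assoc, hRM] using this
  have t11 : (blk 1 1).trace = star (blk 0 0).trace := by
    rw [← Matrix.trace_conjTranspose]
    congr 1
    ext i j
    change R (i, 1) (j, 1) = _
    rw [← hRR]; rfl
  have t01 : (blk 0 1).trace = -star (blk 0 1).trace := by
    rw [← Matrix.trace_conjTranspose, ← Matrix.trace_neg]
    congr 1
    ext i j
    change R (i, 0) (j, 1) = _
    rw [← hRR]; rfl
  have t10 : (blk 1 0).trace = (blk 0 1).trace := by
    have h1 := congrArg Matrix.trace a1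
    have h2 := congrArg Matrix.trace b1
    rw [h1] at h2
    simp only [Matrix.trace_add, Matrix.trace_mul_comm Y] at h2
    simp at h2
    exact h2.resolve_right ht0
  have hB : ∀ s u, blockMean (quat z (ε : ℂ)) X s u = 1 / (N : ℂ) * (blk s u).trace := fun _ _ => rfl
  have hsN : ∀ w : ℂ, star (1 / (N : ℂ) * w) = 1 / (N : ℂ) * star w := by
    intro w; simp
  ext s u
  rw [green, quatMatrix_quat, hB, hB]
  fin_cases s <;> fin_cases u
  · simp [hB]
  · simp only [Fin.zero_eta, Fin.mk_one, Matrix.of_apply, Matrix.cons_val', Matrix.cons_val_zero,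
      Matrix.cons_val_one, Matrix.cons_val_fin_one]
    rw [← mul_assoc, hB]
    simp
  · simp only [Fin.zero_eta, Fin.mk_one, Matrix.of_apply, Matrix.cons_val', Matrix.cons_val_zero,
      Matrix.cons_val_one, Matrix.cons_val_fin_one]
    rw [hB, t10, star_mul', hsN, ← mul_assoc]
    have : Complex.I * star (-Complex.I) = -1 := by simp
    rw [this]
    nth_rewrite 2 [t01]
    ring
  · simp only [Fin.zero_eta, Fin.mk_one, Matrix.of_apply, Matrix.cons_val', Matrix.cons_val_zero,
      Matrix.cons_val_one, Matrix.cons_val_fin_one]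
    rw [hB, hsN, t11]

end QuatGreen

end

/-! Eigenvalue sums are resolvent traces tested against a gradient: the Cauchy kernel gives `φ(μ) =
(1/2π) ∫ dφ_z(conj (1/(μ - z)))`, and summing over the roots of the characteristic polynomial turns
`∑ 1/(μ - z)` into `tr (M - z)⁻¹`. So it suffices to average this trace for `M = X + ε A B⁻¹`, at
almost every `z`.

With `Y = X - z` and `C = ε A + Y B`, one has `M - z = C B⁻¹`, so the trace is `tr (B C⁻¹)`. For
Gaussian `A`, `B` the conditional mean of `B` given `C` is linear in `C`, namely `Yᴴ (Y Yᴴ + ε²)⁻¹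
C`, and the factor `C` cancels: the mean trace is `tr (Yᴴ (Y Yᴴ + ε²)⁻¹)`. The conditioning is
replaced by a symmetry: the orthogonal reflection `reflect` fixes `C`, sends `B` to `2 Yᴴ (Y Yᴴ +
ε²)⁻¹ C - B` and preserves the Gaussian law. Averaging the trace with its reflected copy makes it
deterministic (`integral_trace_inv_perturbed`).

By block elimination (`blockMean_zero_zero`) the result is `N` times the complex component of the
Green's function, and integration by parts (`integral_mul_regDensity`) moves the gradient from `φ`
to it. Fubini is legitimate because `1/|μ - z|` is integrable over bounded regions uniformly in `μ`,
so the integral of `|tr (M - z)⁻¹|` over a bounded set is bounded independently of `M`, and no tail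
estimate on `A B⁻¹` is needed. -/

noncomputable section

namespace QuatGreen

/-! ### The Cauchy kernel in the plane -/

/-- In polar coordinates, the radial derivative recovers a compactly supported function from its
gradient. -/
theorem integral_fderiv_conj_inv_sub {φ : ℂ → ℝ} (hφ : ContDiff ℝ 1 φ) (hc : HasCompactSupport φ)
    (μ : ℂ) :
    ∫ z : ℂ, fderiv ℝ φ z (star ((μ - z)⁻¹)) = 2 * Real.pi * φ μ := by
  set e : ℝ → ℂ := fun θ => (Real.cos θ : ℂ) + Real.sin θ * Complex.I with he
  have hen : ∀ θ, ‖e θ‖ = 1 := by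
    intro θ
    simp [he, ← Complex.exp_mul_I]
  have hec : Continuous e := by fun_prop
  obtain ⟨R, hR⟩ : ∃ R, ∀ z, R ≤ ‖z‖ → φ (μ + z) = 0 := by
    obtain ⟨R, hR⟩ := hc.isCompact.isBounded.subset_ball μ
    refine ⟨R, fun z hz => ?_⟩
    by_contra h
    have := hR (subset_tsupport _ (Function.mem_support.2 h))
    simp at this
    linarith
  have hderiv : ∀ θ r : ℝ, HasDerivAt (fun r : ℝ => φ (μ + r * e θ))
      (fderiv ℝ φ (μ + r * e θ) (e θ)) r := by
    intro θ r
    have h1 : HasDerivAt (fun r : ℝ => μ + (r : ℂ) * e θ) (e θ) r := by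
      have := ((Complex.ofRealCLM.hasDerivAt (x := r)).mul_const (e θ)).const_add μ
      simpa using this
    exact ((hφ.differentiable one_ne_zero _).hasFDerivAt).comp_hasDerivAt r h1
  -- Fundamental theorem of calculus along the ray from `μ` in direction `e θ`; `φ` vanishes far
  -- out.
  have hinner : ∀ θ, ∫ r in Set.Ioi (0 : ℝ), -fderiv ℝ φ (μ + r * e θ) (e θ) = φ μ := by
    intro θ
    have hcd : ContDiff ℝ 1 (fun r : ℝ => φ (μ + r * e θ)) :=
      hφ.comp (contDiff_const.add (Complex.ofRealCLM.contDiff.mul contDiff_const))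
    have hcs : HasCompactSupport (fun r : ℝ => φ (μ + r * e θ)) := by
      refine HasCompactSupport.intro (K := Metric.closedBall 0 R) (isCompact_closedBall _ _) ?_
      intro r hr
      apply hR
      rw [norm_mul, hen, Complex.norm_real]
      simp at hr
      simpa using hr.le
    have h := hcs.integral_Ioi_deriv_eq hcd 0
    rw [integral_neg]
    simp only [fun r => (hderiv θ r).deriv] at h
    rw [h]
    simp
  rw [← integral_add_left_eq_self _ μ, ← Complex.integral_comp_polarCoord_symm]
  have hint : IntegrableOn (fun p : ℝ × ℝ => -fderiv ℝ φ (μ + p.1 * e p.2) (e p.2))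
      (Set.Ioi 0 ×ˢ Set.Ioo (-Real.pi) Real.pi) := by
    have hcont : Continuous (fun p : ℝ × ℝ => -fderiv ℝ φ (μ + p.1 * e p.2) (e p.2)) := by
      have := hφ.continuous_fderiv one_ne_zero
      fun_prop
    have h1 : IntegrableOn (fun p : ℝ × ℝ => -fderiv ℝ φ (μ + p.1 * e p.2) (e p.2))
        (Set.Icc 0 (R + 1) ×ˢ Set.Icc (-Real.pi) Real.pi) :=
      hcont.continuousOn.integrableOn_compact (isCompact_Icc.prod isCompact_Icc)
    refine h1.of_forall_sdiff_eq_zero (measurableSet_Ioi.prod measurableSet_Ioo) ?_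
    rintro ⟨r, θ⟩ ⟨⟨hr, hθ⟩, h2⟩
    have hr' : R + 1 < r := by
      by_contra h
      exact h2 ⟨⟨le_of_lt hr, not_lt.1 h⟩, ⟨hθ.1.le, hθ.2.le⟩⟩
    have hz : (fun r : ℝ => φ (μ + r * e θ)) =ᶠ[nhds r] fun _ => 0 := by
      filter_upwards [lt_mem_nhds hr'] with s hs
      apply hR
      rw [norm_mul, hen, Complex.norm_real]
      simp only [mul_one, Real.norm_eq_abs]
      linarith [le_abs_self s]
    have := (hderiv θ r).unique ((hasDerivAt_const r (0 : ℝ)).congr_of_eventuallyEq hz)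
    simp [this]
  -- At `z = μ + r e` with `|e| = 1`, `conj (1/(μ - z)) = -e/r`, so the Jacobian `r` cancels the
  -- singularity.
  have hcongr : ∫ p in Complex.polarCoord.target, p.1 • fderiv ℝ φ (μ + Complex.polarCoord.symm p)
        (star ((μ - (μ + Complex.polarCoord.symm p))⁻¹))
      = ∫ p in Set.Ioi (0 : ℝ) ×ˢ Set.Ioo (-Real.pi) Real.pi,
        -fderiv ℝ φ (μ + p.1 * e p.2) (e p.2) := by
    refine setIntegral_congr_fun (measurableSet_Ioi.prod measurableSet_Ioo) ?_
    rintro ⟨r, θ⟩ ⟨hr, -⟩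
    have hr0 : (r : ℂ) ≠ 0 := by
      simpa using (ne_of_gt hr)
    have hee : star (e θ) * e θ = 1 := by
      have := Complex.conj_mul' (e θ)
      rw [hen] at this
      simpa using this
    have he0 : e θ ≠ 0 := by
      intro h; simpa [h] using hen θ
    simp only [Complex.polarCoord_symm_apply]
    rw [show (Real.cos θ : ℂ) + Real.sin θ * Complex.I = e θ from rfl, ← map_smul, ← map_neg]
    congr 1
    have h3 : (μ - (μ + r * e θ))⁻¹ = -((r : ℂ)⁻¹ * star (e θ)) := by
      rw [← eq_comm, ← div_eq_one_iff_eq]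
      · field_simp
        linear_combination (r : ℂ) * hee
      · simp [hr0, he0]
    rw [h3, Complex.real_smul]
    simp only [star_neg, star_mul', star_inv₀, Complex.star_def, Complex.conj_ofReal,
      Complex.conj_conj]
    field_simp
  have htgt : (polarCoord.target) = Set.Ioi (0 : ℝ) ×ˢ Set.Ioo (-Real.pi) Real.pi := rfl
  rw [show Complex.polarCoord.target = Set.Ioi (0 : ℝ) ×ˢ Set.Ioo (-Real.pi) Real.pi from rfl]
    at hcongr
  rw [htgt, hcongr, Measure.volume_eq_prod, ← Measure.prod_restrict, integral_prod_symm]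
  · simp only [hinner, integral_const, measureReal_restrict_apply_univ, Real.volume_real_Ioo_of_le
      (neg_le_self Real.pi_pos.le), smul_eq_mul]
    ring
  · rw [Measure.prod_restrict]
    exact hint

/-- The kernel `1 / |μ - z|` is integrable over bounded regions, uniformly in `μ`. -/
theorem lintegral_inv_sub_le (μ : ℂ) (K : Set ℂ) :
    ∫⁻ z in K, ‖(μ - z)⁻¹‖ₑ ≤ volume K + ENNReal.ofReal (2 * Real.pi) := by
  -- In polar coordinates the Jacobian cancels `1/r`; what remains is the area `2π` of `(0,1) ×
  -- (-π,π)`. Outside the unit ball the kernel is at most `1`.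
  have hball : ∫⁻ z in Metric.ball μ 1, ‖(μ - z)⁻¹‖ₑ ≤ ENNReal.ofReal (2 * Real.pi) := by
    rw [← lintegral_indicator measurableSet_ball, ← lintegral_add_left_eq_self _ μ,
      ← Complex.lintegral_comp_polarCoord_symm]
    have htgt : (polarCoord.target) = Set.Ioi (0 : ℝ) ×ˢ Set.Ioo (-Real.pi) Real.pi := rfl
    rw [htgt]
    have h1 : ∀ p ∈ Set.Ioi (0 : ℝ) ×ˢ Set.Ioo (-Real.pi) Real.pi,
        ENNReal.ofReal p.1 • (Metric.ball μ 1).indicator (fun z => ‖(μ - z)⁻¹‖ₑ)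
          (μ + Complex.polarCoord.symm p)
        ≤ (Set.Iio (1 : ℝ) ×ˢ Set.univ).indicator (fun _ => 1) p := by
      rintro ⟨r, θ⟩ ⟨hr, -⟩
      have hr : 0 < r := hr
      have hn : ‖Complex.polarCoord.symm (r, θ)‖ = r := by
        rw [Complex.norm_polarCoord_symm]; exact abs_of_pos hr
      by_cases hr1 : r < 1
      · rw [Set.indicator_of_mem, Set.indicator_of_mem]
        · rw [sub_add_cancel_left, ← ofReal_norm, norm_inv, norm_neg, hn, smul_eq_mul,
            ← ENNReal.ofReal_mul hr.le, mul_inv_cancel₀ hr.ne', ENNReal.ofReal_one]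
        · exact ⟨hr1, trivial⟩
        · simpa [abs_of_pos hr] using hr1
      · rw [Set.indicator_of_notMem]
        · simp
        · simp only [Metric.mem_ball, dist_self_add_left, hn]
          exact hr1
    refine (setLIntegral_mono' (measurableSet_Ioi.prod measurableSet_Ioo) h1).trans ?_
    rw [lintegral_indicator (measurableSet_Iio.prod MeasurableSet.univ), setLIntegral_one,
      Measure.restrict_apply (measurableSet_Iio.prod MeasurableSet.univ), Set.prod_inter_prod,
      Measure.volume_eq_prod, Measure.prod_prod, Set.univ_inter, Set.inter_comm, Set.Ioi_inter_Iio,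
      Real.volume_Ioo, Real.volume_Ioo, ← ENNReal.ofReal_mul (by norm_num)]
    apply le_of_eq
    congr 1
    ring
  calc ∫⁻ z in K, ‖(μ - z)⁻¹‖ₑ
      ≤ ∫⁻ z in K ∩ (Metric.ball μ 1)ᶜ ∪ Metric.ball μ 1, ‖(μ - z)⁻¹‖ₑ := by
        refine lintegral_mono_set fun z hz => ?_
        by_cases h : z ∈ Metric.ball μ 1
        · exact Or.inr h
        · exact Or.inl ⟨hz, h⟩
    _ ≤ (∫⁻ z in K ∩ (Metric.ball μ 1)ᶜ, ‖(μ - z)⁻¹‖ₑ) + ∫⁻ z in Metric.ball μ 1, ‖(μ - z)⁻¹‖ₑ :=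
        lintegral_union_le _ _ _
    _ ≤ volume K + ENNReal.ofReal (2 * Real.pi) := by
        refine add_le_add ?_ hball
        calc ∫⁻ z in K ∩ (Metric.ball μ 1)ᶜ, ‖(μ - z)⁻¹‖ₑ
            ≤ ∫⁻ z in K ∩ (Metric.ball μ 1)ᶜ, 1 := by
              refine lintegral_mono_ae ?_
              have hm : ∀ᵐ z ∂(volume.restrict (K ∩ (Metric.ball μ 1)ᶜ)),
                  z ∈ (Metric.ball μ 1)ᶜ := by
                refine ae_mono (Measure.restrict_mono Set.inter_subset_right le_rfl) ?_
                exact ae_restrict_mem measurableSet_ball.compl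
              filter_upwards [hm] with z hz
              rw [← ofReal_norm, norm_inv, ENNReal.ofReal_le_one]
              apply inv_le_one_of_one_le₀
              simpa [dist_eq_norm, norm_sub_rev] using hz
          _ = volume (K ∩ (Metric.ball μ 1)ᶜ) := setLIntegral_one _
          _ ≤ volume K := measure_mono Set.inter_subset_left

/-! ### Resolvent trace and characteristic polynomial -/

/-- The trace of the resolvent of a matrix is the logarithmic derivative of its characteristic
polynomial. -/
theorem trace_inv_sub_smul_one {n : Type*} [Fintype n] [DecidableEq n] (M : Matrix n n ℂ) {z : ℂ}
    (hz : M.charpoly.eval z ≠ 0) :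
    ((M - z • (1 : Matrix n n ℂ))⁻¹).trace = (M.charpoly.roots.map fun μ => (μ - z)⁻¹).sum := by
  classical
  set Q : Matrix n n ℂ := z • (1 : Matrix n n ℂ) - M with hQ
  have hdet : M.charpoly.eval z = Q.det := by
    rw [Matrix.eval_charpoly, hQ]
    congr 2
    ext i j
    simp [Matrix.scalar_apply, Matrix.diagonal_apply, Matrix.one_apply]
  have hQu : IsUnit Q.det := by rw [← hdet]; exact hz.isUnit
  -- Factor `det (t + z - M) = det Q · det (1 + t Q⁻¹)`; the derivative at `t = 0` of the second
  -- determinant is `tr Q⁻¹`.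
  have hcomp : M.charpoly.comp (Polynomial.X + Polynomial.C z)
      = Polynomial.C Q.det * (1 + (Polynomial.X : Polynomial ℂ) • Q⁻¹.map Polynomial.C).det := by
    refine Polynomial.funext fun t => ?_
    rw [Polynomial.eval_comp, Polynomial.eval_mul, Polynomial.eval_C, Matrix.eval_charpoly]
    have h1 : Polynomial.eval t (1 + (Polynomial.X : Polynomial ℂ) • Q⁻¹.map Polynomial.C).det
        = (1 + t • Q⁻¹).det := by
      rw [← Polynomial.coe_evalRingHom, RingHom.map_det]
      congr 1
      ext i j
      by_cases h : i = j <;> simp [h, mul_comm t]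
    rw [h1, ← Matrix.det_mul, mul_add, mul_one, mul_smul_comm, Matrix.mul_nonsing_inv _ hQu]
    congr 1
    ext i j
    simp [hQ, Matrix.scalar_apply, Matrix.diagonal_apply, Matrix.one_apply]
    split_ifs <;> ring
  have hder := congrArg (fun p => (Polynomial.derivative p).eval 0) hcomp
  simp only [Polynomial.derivative_comp, Polynomial.derivative_mul, Polynomial.derivative_C,
    zero_mul, zero_add, Polynomial.eval_mul, Polynomial.eval_C, Polynomial.eval_comp,
    Polynomial.derivative_add, Polynomial.derivative_X, add_zero, Polynomial.eval_add,
    Polynomial.eval_X, one_mul,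
    Matrix.derivative_det_one_add_X_smul] at hder
  rw [(IsAlgClosed.splits _).eval_derivative_eq_eval_mul_sum hz, hdet] at hder
  have h2 := mul_left_cancel₀ hQu.ne_zero hder
  have hneg : M - z • (1 : Matrix n n ℂ) = -Q := by rw [hQ]; abel
  have hinv : (-Q)⁻¹ = -Q⁻¹ := by
    apply Matrix.inv_eq_right_inv
    rw [neg_mul_neg, Matrix.mul_nonsing_inv _ hQu]
  rw [hneg, hinv, Matrix.trace_neg, ← h2, ← Multiset.sum_map_neg]
  congr 1
  refine Multiset.map_congr rfl fun μ _ => ?_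
  rw [one_div, ← inv_neg, neg_sub]

/-! ### Gaussian measure and isometric involutions -/

section Gaussian

variable {ι : Type*} [Fintype ι]

theorem integrable_gaussian_density [IsFiniteMeasure stdComplexGaussian] :
    Integrable (fun z : ℂ => 1 / Real.pi * Real.exp (-‖z‖ ^ 2)) := by
  refine ⟨by fun_prop, ?_⟩
  have h := measure_lt_top stdComplexGaussian Set.univ
  rw [stdComplexGaussian, withDensity_apply _ MeasurableSet.univ, Measure.restrict_univ] at h
  rwa [hasFiniteIntegral_iff_ofReal (Filter.Eventually.of_forall fun z => by positivity)]

/-- The joint density of independent standard complex Gaussian variables. -/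
theorem pi_stdComplexGaussian [IsFiniteMeasure stdComplexGaussian] :
    Measure.pi (fun _ : ι => stdComplexGaussian) = (volume : Measure (ι → ℂ)).withDensity
      fun x => ENNReal.ofReal ((1 / Real.pi) ^ Fintype.card ι * Real.exp (-∑ i, ‖x i‖ ^ 2)) := by
  refine Measure.pi_eq fun s hs => ?_
  have hprod : ∀ x : ι → ℂ, (1 / Real.pi) ^ Fintype.card ι * Real.exp (-∑ i, ‖x i‖ ^ 2)
      = ∏ i, (1 / Real.pi * Real.exp (-‖x i‖ ^ 2)) := by
    intro x
    rw [Finset.prod_mul_distrib, Finset.prod_const, ← Real.exp_sum, Finset.sum_neg_distrib]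
    rfl
  have hint : ∀ i, Integrable (fun z : ℂ => 1 / Real.pi * Real.exp (-‖z‖ ^ 2))
      (volume.restrict (s i)) := fun i => integrable_gaussian_density.integrableOn
  rw [withDensity_apply _ (MeasurableSet.univ_pi hs)]
  simp only [hprod]
  rw [volume_pi, Measure.restrict_pi_pi, ← ofReal_integral_eq_lintegral_ofReal,
    integral_fintype_prod_eq_prod (𝕜 := ℝ) (fun _ z => 1 / Real.pi * Real.exp (-‖z‖ ^ 2)),
    ENNReal.ofReal_prod_of_nonneg]
  · refine Finset.prod_congr rfl fun i _ => ?_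
    rw [stdComplexGaussian, withDensity_apply _ (hs i), ofReal_integral_eq_lintegral_ofReal (hint i)]
    exact Filter.Eventually.of_forall fun z => by positivity
  · exact fun i _ => integral_nonneg fun z => by positivity
  · exact Integrable.fintype_prod (f := fun _ z => 1 / Real.pi * Real.exp (-‖z‖ ^ 2)) hint
  · exact Filter.Eventually.of_forall fun z => Finset.prod_nonneg fun i _ => by positivity

/-- The standard Gaussian law is invariant under isometric linear involutions. -/
theorem measurePreserving_of_involutive [IsFiniteMeasure stdComplexGaussian]
    (T : (ι → ℂ) →ₗ[ℝ] (ι → ℂ)) (hT : ∀ x, T (T x) = x)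
    (hn : ∀ x, ∑ i, ‖T x i‖ ^ 2 = ∑ i, ‖x i‖ ^ 2) :
    MeasurePreserving T (Measure.pi fun _ : ι => stdComplexGaussian)
      (Measure.pi fun _ : ι => stdComplexGaussian) := by
  have hTm : Measurable T := (LinearMap.continuous_of_finiteDimensional T).measurable
  -- An involution has determinant `±1`, hence preserves Lebesgue measure; the density depends only
  -- on the preserved norm.
  have hsq : LinearMap.det T * LinearMap.det T = 1 := by
    rw [← LinearMap.det_comp, show T ∘ₗ T = LinearMap.id from LinearMap.ext hT, LinearMap.det_id]
  have habs : |(LinearMap.det T)⁻¹| = 1 := by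
    rcases mul_self_eq_one_iff.1 hsq with h | h <;> simp [h]
  have hvol : Measure.map T (volume : Measure (ι → ℂ)) = volume := by
    rw [Measure.map_linearMap_addHaar_eq_smul_addHaar _ (left_ne_zero_of_mul_eq_one hsq), habs]
    simp
  refine ⟨hTm, ?_⟩
  rw [pi_stdComplexGaussian]
  ext s hs
  rw [Measure.map_apply hTm hs, withDensity_apply _ hs, withDensity_apply _ (hTm hs)]
  conv_rhs => rw [← hvol]
  rw [setLIntegral_map hs (by fun_prop) hTm]
  simp only [hn]

end Gaussian

/-! ### The reflection fixing the pencil -/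

section Reflection

variable {n : Type*}

/-- The pair of matrices with the given entries, first component. -/
def fstMatrix (s : (n × n) ⊕ (n × n) → ℂ) : Matrix n n ℂ := Matrix.of fun i j => s (.inl (i, j))

/-- The pair of matrices with the given entries, second component. -/
def sndMatrix (s : (n × n) ⊕ (n × n) → ℂ) : Matrix n n ℂ := Matrix.of fun i j => s (.inr (i, j))

/-- The entries of a pair of matrices. -/
def entries (A B : Matrix n n ℂ) : (n × n) ⊕ (n × n) → ℂ :=
  Sum.elim (fun p => A p.1 p.2) (fun p => B p.1 p.2)

theorem entries_fst_snd (s : (n × n) ⊕ (n × n) → ℂ) : entries (fstMatrix s) (sndMatrix s) = s := by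
  ext (p | p) <;> rfl

variable [Fintype n]

theorem trace_conjTranspose_mul_self (A : Matrix n n ℂ) :
    (Aᴴ * A).trace = ((∑ p : n × n, ‖A p.1 p.2‖ ^ 2 : ℝ) : ℂ) := by
  rw [Fintype.sum_prod_type_right, Matrix.trace]
  push_cast
  refine Finset.sum_congr rfl fun i _ => ?_
  rw [Matrix.diag_apply, Matrix.mul_apply]
  refine Finset.sum_congr rfl fun j _ => ?_
  simpa using Complex.conj_mul' (A j i)

theorem sum_sq_norm_eq_trace (s : (n × n) ⊕ (n × n) → ℂ) :
    ((∑ k, ‖s k‖ ^ 2 : ℝ) : ℂ)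
      = ((fstMatrix s)ᴴ * fstMatrix s + (sndMatrix s)ᴴ * sndMatrix s).trace := by
  rw [Matrix.trace_add, trace_conjTranspose_mul_self, trace_conjTranspose_mul_self,
    Fintype.sum_sum_type, Complex.ofReal_add]
  rfl

variable [DecidableEq n]

/-- The regularised covariance `Y Yᴴ + ε²`. -/
def regCov (ε : ℝ) (Y : Matrix n n ℂ) : Matrix n n ℂ := Y * Yᴴ + (ε : ℂ) ^ 2 • 1

open scoped ComplexOrder in
theorem isUnit_det_regCov {ε : ℝ} (hε : ε ≠ 0) (Y : Matrix n n ℂ) : IsUnit (regCov ε Y).det := by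
  rw [← Matrix.isUnit_iff_isUnit_det]
  have h2 : ((ε : ℂ) ^ 2 • (1 : Matrix n n ℂ)).PosDef := by
    refine Matrix.PosDef.smul Matrix.PosDef.one ?_
    rw [← Complex.ofReal_pow, Complex.zero_lt_real]
    positivity
  exact (Matrix.PosDef.posSemidef_add (Matrix.posSemidef_self_mul_conjTranspose Y) h2).isUnit

theorem regCov_conjTranspose (ε : ℝ) (Y : Matrix n n ℂ) : (regCov ε Y)ᴴ = regCov ε Y := by
  simp [regCov]

/-- The pencil `ε A + Y B`. -/
def pencil (ε : ℝ) (Y : Matrix n n ℂ) (s : (n × n) ⊕ (n × n) → ℂ) : Matrix n n ℂ :=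
  (ε : ℂ) • fstMatrix s + Y * sndMatrix s

/-- The orthogonal reflection of pairs of matrices that fixes the pencil `ε A + Y B`. -/
def reflect (ε : ℝ) (Y : Matrix n n ℂ) : ((n × n) ⊕ (n × n) → ℂ) →ₗ[ℝ] ((n × n) ⊕ (n × n) → ℂ) where
  -- With `C` the pencil and `H = (Y Yᴴ + ε²)⁻¹`, the pair `(ε H C, Yᴴ H C)` is the orthogonal
  -- projection of `(A, B)` onto the complement of the pencil's kernel; the reflection is twice this
  -- projection minus the identity.
  toFun s := entries ((2 * ε : ℂ) • ((regCov ε Y)⁻¹ * pencil ε Y s) - fstMatrix s)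
    ((2 : ℂ) • (Yᴴ * (regCov ε Y)⁻¹ * pencil ε Y s) - sndMatrix s)
  map_add' s t := by
    have h1 : fstMatrix (s + t) = fstMatrix s + fstMatrix t := rfl
    have h2 : sndMatrix (s + t) = sndMatrix s + sndMatrix t := rfl
    have h3 : pencil ε Y (s + t) = pencil ε Y s + pencil ε Y t := by
      simp only [pencil, h1, h2, smul_add, mul_add]; abel
    rw [h1, h2, h3]
    ext (p | p) <;> simp [entries, mul_add] <;> ring
  map_smul' c s := by
    have h1 : fstMatrix (c • s) = c • fstMatrix s := rfl
    have h2 : sndMatrix (c • s) = c • sndMatrix s := rfl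
    have h3 : pencil ε Y (c • s) = c • pencil ε Y s := by
      rw [pencil, pencil, h1, h2, smul_add, smul_comm (ε : ℂ) c, mul_smul_comm]
    rw [h1, h2, h3, mul_smul_comm, mul_smul_comm, smul_comm _ c, smul_comm _ c, ← smul_sub,
      ← smul_sub]
    ext (p | p) <;> rfl

theorem fstMatrix_reflect (ε : ℝ) (Y : Matrix n n ℂ) (s : (n × n) ⊕ (n × n) → ℂ) :
    fstMatrix (reflect ε Y s)
      = (2 * ε : ℂ) • ((regCov ε Y)⁻¹ * pencil ε Y s) - fstMatrix s := rfl

theorem sndMatrix_reflect (ε : ℝ) (Y : Matrix n n ℂ) (s : (n × n) ⊕ (n × n) → ℂ) :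
    sndMatrix (reflect ε Y s)
      = (2 : ℂ) • (Yᴴ * (regCov ε Y)⁻¹ * pencil ε Y s) - sndMatrix s := rfl

/-- The projected pair has the same pencil, because `(ε² + Y Yᴴ) H C = C`; the reflected pencil is
then `2 C - C`. -/
theorem pencil_reflect {ε : ℝ} (hε : ε ≠ 0) (Y : Matrix n n ℂ) (s : (n × n) ⊕ (n × n) → ℂ) :
    pencil ε Y (reflect ε Y s) = pencil ε Y s := by
  have h : (ε : ℂ) ^ 2 • ((regCov ε Y)⁻¹ * pencil ε Y s)
      + Y * Yᴴ * ((regCov ε Y)⁻¹ * pencil ε Y s) = pencil ε Y s := by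
    have := congrArg (· * pencil ε Y s) (Matrix.mul_nonsing_inv _ (isUnit_det_regCov hε Y))
    simp only [one_mul, mul_assoc] at this
    conv_rhs => rw [← this]
    nth_rewrite 3 [regCov]
    rw [add_mul, smul_mul_assoc, one_mul, add_comm]
  calc pencil ε Y (reflect ε Y s)
      = (2 : ℂ) • ((ε : ℂ) ^ 2 • ((regCov ε Y)⁻¹ * pencil ε Y s)
          + Y * Yᴴ * ((regCov ε Y)⁻¹ * pencil ε Y s)) - pencil ε Y s := by
        rw [pencil, fstMatrix_reflect, sndMatrix_reflect, mul_assoc Yᴴ]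
        generalize (regCov ε Y)⁻¹ * pencil ε Y s = D
        rw [pencil]
        simp only [smul_sub, mul_sub, smul_add, smul_smul, mul_smul_comm, mul_assoc]
        rw [show (ε : ℂ) * (2 * ε) = 2 * ε ^ 2 by ring]
        abel
    _ = pencil ε Y s := by rw [h, two_smul]; abel

/-- Since the pencil is fixed, the second reflection subtracts from the same doubled projection as
the first. -/
theorem reflect_reflect {ε : ℝ} (hε : ε ≠ 0) (Y : Matrix n n ℂ) (s : (n × n) ⊕ (n × n) → ℂ) :
    reflect ε Y (reflect ε Y s) = s := by
  conv_rhs => rw [← entries_fst_snd s]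
  conv_lhs => rw [← entries_fst_snd (reflect ε Y (reflect ε Y s))]
  rw [fstMatrix_reflect, sndMatrix_reflect, pencil_reflect hε, fstMatrix_reflect,
    sndMatrix_reflect, sub_sub_cancel, sub_sub_cancel]

theorem sum_sq_norm_reflect {ε : ℝ} (hε : ε ≠ 0) (Y : Matrix n n ℂ)
    (s : (n × n) ⊕ (n × n) → ℂ) :
    ∑ k, ‖reflect ε Y s k‖ ^ 2 = ∑ k, ‖s k‖ ^ 2 := by
  rw [← Complex.ofReal_inj, sum_sq_norm_eq_trace, sum_sq_norm_eq_trace]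
  rw [fstMatrix_reflect, sndMatrix_reflect]
  congr 1
  set A := fstMatrix s with hA
  set B := sndMatrix s with hB
  set C := pencil ε Y s with hC
  set H := (regCov ε Y)⁻¹ with hH
  have hCd : C = (ε : ℂ) • A + Y * B := rfl
  have hHH : Hᴴ = H := by rw [hH, Matrix.conjTranspose_nonsing_inv, regCov_conjTranspose]
  have hHG : H * ((ε : ℂ) ^ 2 • 1 + Y * Yᴴ) = 1 := by
    rw [add_comm]; exact Matrix.nonsing_inv_mul _ (isUnit_det_regCov hε Y)
  -- Three expansions of `Cᴴ H C`: the squared norm of the projection, and its two cross terms with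
  -- `(A, B)`.
  have h1 : Cᴴ * H * C = (ε : ℂ) ^ 2 • (Cᴴ * H * H * C) + Cᴴ * H * Y * Yᴴ * H * C := by
    calc Cᴴ * H * C = Cᴴ * (H * ((ε : ℂ) ^ 2 • 1 + Y * Yᴴ)) * (H * C) := by
          rw [hHG, mul_one, mul_assoc]
      _ = _ := by
          simp only [mul_add, add_mul, mul_smul_comm, smul_mul_assoc, mul_one, mul_assoc]
  have h2 : Cᴴ * H * C = (ε : ℂ) • (Cᴴ * H * A) + Cᴴ * H * Y * B := by
    nth_rewrite 2 [hCd]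
    simp only [mul_add, mul_smul_comm, mul_assoc]
  have h3 : Cᴴ * H * C = (ε : ℂ) • (Aᴴ * H * C) + Bᴴ * Yᴴ * H * C := by
    have := congrArg Matrix.conjTranspose h2
    simpa [hHH, mul_assoc] using this
  have e1 : ((2 * ε : ℂ) • (H * C) - A)ᴴ * ((2 * ε : ℂ) • (H * C) - A)
      = (4 : ℂ) • ((ε : ℂ) ^ 2 • (Cᴴ * H * H * C)) - (2 : ℂ) • ((ε : ℂ) • (Cᴴ * H * A))
        - (2 : ℂ) • ((ε : ℂ) • (Aᴴ * H * C)) + Aᴴ * A := by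
    simp only [Matrix.conjTranspose_sub, Matrix.conjTranspose_smul, Matrix.conjTranspose_mul, hHH,
      sub_mul, mul_sub, smul_mul_assoc, mul_smul_comm, smul_smul, mul_assoc]
    simp only [star_mul', Complex.star_def, Complex.conj_ofReal, Complex.conj_ofNat]
    module
  have e2 : ((2 : ℂ) • (Yᴴ * H * C) - B)ᴴ * ((2 : ℂ) • (Yᴴ * H * C) - B)
      = (4 : ℂ) • (Cᴴ * H * Y * Yᴴ * H * C) - (2 : ℂ) • (Cᴴ * H * Y * B)
        - (2 : ℂ) • (Bᴴ * Yᴴ * H * C) + Bᴴ * B := by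
    simp only [Matrix.conjTranspose_sub, Matrix.conjTranspose_smul, Matrix.conjTranspose_mul, hHH,
      sub_mul, mul_sub, smul_mul_assoc, mul_smul_comm, mul_assoc,
      Matrix.conjTranspose_conjTranspose]
    simp only [Complex.star_def, Complex.conj_ofNat]
    module
  rw [e1, e2]
  -- The cross terms cancel in the expanded squares: `4 Cᴴ H C - 2 Cᴴ H C - 2 Cᴴ H C = 0`.
  linear_combination (norm := module) (-4 : ℂ) • h1 + (2 : ℂ) • h2 + (2 : ℂ) • h3

theorem measurePreserving_reflect [IsFiniteMeasure stdComplexGaussian] {ε : ℝ} (hε : ε ≠ 0)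
    (Y : Matrix n n ℂ) :
    MeasurePreserving (reflect ε Y) (Measure.pi fun _ => stdComplexGaussian)
      (Measure.pi fun _ => stdComplexGaussian) :=
  measurePreserving_of_involutive _ (reflect_reflect hε Y) (sum_sq_norm_reflect hε Y)

end Reflection

/-! ### Smooth dependence of determinants and inverses -/

section Smoothness

variable {E : Type*} [NormedAddCommGroup E] [NormedSpace ℝ E] {m : Type*} [Fintype m]
  [DecidableEq m] {k : WithTop ℕ∞}

theorem contDiff_matrix_det {M : E → Matrix m m ℂ} (hM : ∀ i j, ContDiff ℝ k fun z => M z i j) :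
    ContDiff ℝ k fun z => (M z).det := by
  simp only [Matrix.det_apply, Units.smul_def, zsmul_eq_mul]
  exact ContDiff.sum fun σ _ => contDiff_const.mul (contDiff_prod fun i _ => hM _ _)

/-- Cramer's rule: entries of the inverse are determinants divided by a nonvanishing determinant. -/
theorem contDiff_matrix_inv_apply {M : E → Matrix m m ℂ}
    (hM : ∀ i j, ContDiff ℝ k fun z => M z i j) (hu : ∀ z, IsUnit (M z)) (i j : m) :
    ContDiff ℝ k fun z => (M z)⁻¹ i j := by
  simp only [Matrix.inv_def, Ring.inverse_eq_inv', Matrix.smul_apply, smul_eq_mul,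
    Matrix.adjugate_apply]
  refine (ContDiff.inv (contDiff_matrix_det hM) fun z => ?_).mul (contDiff_matrix_det fun a b => ?_)
  · exact ((Matrix.isUnit_iff_isUnit_det _).1 (hu z)).ne_zero
  · by_cases h : a = j
    · subst h
      simpa using contDiff_const
    · simpa [Matrix.updateRow_ne h] using hM a b

end Smoothness

/-! ### The Green's function and its complex component -/

variable {N : ℕ}

theorem contDiff_blockMean (X : Matrix (Fin N) (Fin N) ℂ) {ε : ℝ} (hε : ε ≠ 0) (s t : Fin 2)
    {k : WithTop ℕ∞} : ContDiff ℝ k fun z : ℂ => blockMean (quat z (ε : ℂ)) X s t := by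
  have hstar : ContDiff ℝ k fun z : ℂ => star z := Complex.conjCLE.contDiff
  simp only [blockMean, resolvent, Matrix.of_apply]
  refine contDiff_const.mul (ContDiff.sum fun i _ => ?_)
  refine contDiff_matrix_inv_apply (fun p r => ?_) (fun z => isUnit_shifted X z hε) _ _
  simp only [shifted, Matrix.sub_apply, Matrix.kroneckerMap_apply, quatMatrix_quat]
  refine contDiff_const.sub (contDiff_const.mul ?_)
  obtain ⟨p, a⟩ := p
  obtain ⟨r, b⟩ := r
  fin_cases a <;> fin_cases b
  · exact contDiff_id
  · exact contDiff_const
  · exact contDiff_const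
  · exact hstar

@[simp] theorem quat_re (a b : ℂ) : (quat a b).re = a.re := rfl

@[simp] theorem quat_imI (a b : ℂ) : (quat a b).imI = a.im := rfl

@[simp] theorem quat_imJ (a b : ℂ) : (quat a b).imJ = b.re := rfl

@[simp] theorem quat_imK (a b : ℂ) : (quat a b).imK = b.im := rfl

theorem quat_eq (a b : ℂ) : quat a b = a.re • (1 : ℍ[ℝ]) + a.im • quat Complex.I 0
    + b.re • quat 0 1 + b.im • quat 0 Complex.I := by
  ext <;> simp

theorem contDiff_green (X : Matrix (Fin N) (Fin N) ℂ) {ε : ℝ} (hε : ε ≠ 0)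
    {k : WithTop ℕ∞} : ContDiff ℝ k fun z : ℂ => green (quat z (ε : ℂ)) X := by
  simp only [green, quat_eq (blockMean _ _ _ _)]
  have h := fun s t => contDiff_blockMean X hε s t (k := k)
  have h0 := h 0 0
  have h1 : ContDiff ℝ k fun z : ℂ => -Complex.I * blockMean (quat z (ε : ℂ)) X 0 1 :=
    contDiff_const.mul (h 0 1)
  have hre : ∀ {f : ℂ → ℂ}, ContDiff ℝ k f → ContDiff ℝ k fun z => (f z).re :=
    fun hf => Complex.reCLM.contDiff.comp hf
  have him : ∀ {f : ℂ → ℂ}, ContDiff ℝ k f → ContDiff ℝ k fun z => (f z).im :=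
    fun hf => Complex.imCLM.contDiff.comp hf
  exact ((((hre h0).smul contDiff_const).add ((him h0).smul contDiff_const)).add
    ((hre h1).smul contDiff_const)).add ((him h1).smul contDiff_const)

/-- The real part of the quaternionic `∂/∂z̄` only sees the complex component of the function. -/
theorem regDensity_eq (X : Matrix (Fin N) (Fin N) ℂ) {ε : ℝ} (hε : ε ≠ 0) (z : ℂ) :
    regDensity ε X z = -(1 / (2 * Real.pi)) *
      (fderiv ℝ (fun w : ℂ => (blockMean (quat w (ε : ℂ)) X 0 0).re) z 1
        - fderiv ℝ (fun w : ℂ => (blockMean (quat w (ε : ℂ)) X 0 0).im) z Complex.I) := by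
  let reL : ℍ[ℝ] →L[ℝ] ℝ := LinearMap.toContinuousLinearMap
    { toFun := fun q => q.re, map_add' := fun _ _ => rfl, map_smul' := fun _ _ => rfl }
  let imL : ℍ[ℝ] →L[ℝ] ℝ := LinearMap.toContinuousLinearMap
    { toFun := fun q => q.imI, map_add' := fun _ _ => rfl, map_smul' := fun _ _ => rfl }
  have hd : DifferentiableAt ℝ (fun w : ℂ => green (quat w (ε : ℂ)) X) z :=
    (contDiff_green X hε (k := 1)).differentiable one_ne_zero z
  have h1 : fderiv ℝ (fun w : ℂ => (blockMean (quat w (ε : ℂ)) X 0 0).re) z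
      = reL.comp (fderiv ℝ (fun w : ℂ => green (quat w (ε : ℂ)) X) z) :=
    (reL.hasFDerivAt.comp z hd.hasFDerivAt).fderiv
  have h2 : fderiv ℝ (fun w : ℂ => (blockMean (quat w (ε : ℂ)) X 0 0).im) z
      = imL.comp (fderiv ℝ (fun w : ℂ => green (quat w (ε : ℂ)) X) z) :=
    (imL.hasFDerivAt.comp z hd.hasFDerivAt).fderiv
  rw [regDensity, dbar, h1, h2]
  generalize fderiv ℝ (fun w : ℂ => green (quat w (ε : ℂ)) X) z = D
  have e1 : (reL.comp D) 1 = (D 1).re := rfl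
  have e2 : (imL.comp D) Complex.I = (D Complex.I).imI := rfl
  rw [e1, e2]
  simp only [Quaternion.re_smul, Quaternion.re_add, Quaternion.re_mul, quat_re, quat_imI, quat_imJ,
    quat_imK, Complex.I_re, Complex.I_im, Complex.zero_re, Complex.zero_im, smul_eq_mul]
  ring

/-- The complex component of the Green's function. -/
theorem blockMean_zero_zero (X : Matrix (Fin N) (Fin N) ℂ) {ε : ℝ} (hε : ε ≠ 0) (z : ℂ) :
    blockMean (quat z (ε : ℂ)) X 0 0 = 1 / (N : ℂ) *
      ((X - z • (1 : Matrix (Fin N) (Fin N) ℂ))ᴴ * (regCov ε (X - z • 1))⁻¹).trace := by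
  set Y := X - z • (1 : Matrix (Fin N) (Fin N) ℂ) with hY
  set R := resolvent (quat z (ε : ℂ)) X with hR
  have hMR : shifted (quat z (ε : ℂ)) X * R = 1 :=
    Matrix.mul_nonsing_inv _ ((Matrix.isUnit_iff_isUnit_det _).1 (isUnit_shifted X z hε))
  set R0 : Matrix (Fin N) (Fin N) ℂ := Matrix.of fun i j => R (i, 0) (j, 0) with hR0
  set R1 : Matrix (Fin N) (Fin N) ℂ := Matrix.of fun i j => R (i, 1) (j, 0) with hR1
  have h0 : Y * R0 - (Complex.I * ε) • R1 = 1 := by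
    ext i j
    have h := congrFun (congrFun hMR (i, 0)) (j, 0)
    simp only [Matrix.mul_apply, Fintype.sum_prod_type, Fin.sum_univ_two,
      (shifted_blocks X z ε _ _).1, (shifted_blocks X z ε _ _).2.1, Finset.sum_add_distrib] at h
    rw [← hY] at h
    simp [Matrix.one_apply] at h
    simp [Matrix.mul_apply, Matrix.one_apply, hR0, hR1, ← h, sub_eq_add_neg]
  have h1 : Yᴴ * R1 = (Complex.I * ε) • R0 := by
    ext i j
    have h := congrFun (congrFun hMR (i, 1)) (j, 0)
    simp only [Matrix.mul_apply, Fintype.sum_prod_type, Fin.sum_univ_two,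
      (shifted_blocks X z ε _ _).2.2.1, (shifted_blocks X z ε _ _).2.2.2,
      Finset.sum_add_distrib] at h
    rw [← hY] at h
    simp [Matrix.one_apply, -Matrix.conjTranspose_apply] at h
    simp [Matrix.mul_apply, hR0, hR1, -Matrix.conjTranspose_apply]
    linear_combination h
  have hIε : Complex.I * (ε : ℂ) ≠ 0 := by simp [hε]
  -- Eliminate `R0` from the two block equations `h0` and `h1` of the first block column of the
  -- inverse.
  have h2 : regCov ε Y * R1 = (Complex.I * ε) • 1 := by
    rw [regCov, add_mul, mul_assoc, h1, smul_mul_assoc, one_mul]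
    conv_rhs => rw [← h0]
    simp only [mul_smul_comm, smul_sub, smul_smul]
    rw [show Complex.I * (ε : ℂ) * (Complex.I * ε) = -(ε : ℂ) ^ 2 by
      linear_combination (ε : ℂ) ^ 2 * Complex.I_mul_I]
    module
  have h3 : R1 = (Complex.I * ε) • (regCov ε Y)⁻¹ := by
    have := congrArg ((regCov ε Y)⁻¹ * ·) h2
    simpa [← mul_assoc, Matrix.nonsing_inv_mul _ (isUnit_det_regCov hε Y)] using this
  have h4 : R0 = Yᴴ * (regCov ε Y)⁻¹ := by
    rw [h3, mul_smul_comm] at h1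
    exact (smul_right_injective _ hIε h1).symm
  rw [← h4]
  rfl

/-- Integration by parts in each real direction; boundary terms vanish by compact support, and the
minus sign in `regDensity` is absorbed. -/
theorem integral_mul_regDensity (X : Matrix (Fin N) (Fin N) ℂ) {ε : ℝ} (hε : ε ≠ 0) {φ : ℂ → ℝ}
    (hφ : ContDiff ℝ 1 φ) (hc : HasCompactSupport φ) :
    ∫ z, φ z * regDensity ε X z = 1 / (2 * Real.pi) *
      ∫ z, fderiv ℝ φ z (star (blockMean (quat z (ε : ℂ)) X 0 0)) := by
  have hb := contDiff_blockMean X hε 0 0 (k := 1)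
  have hre : ContDiff ℝ 1 fun z : ℂ => (blockMean (quat z (ε : ℂ)) X 0 0).re :=
    Complex.reCLM.contDiff.comp hb
  have him : ContDiff ℝ 1 fun z : ℂ => (blockMean (quat z (ε : ℂ)) X 0 0).im :=
    Complex.imCLM.contDiff.comp hb
  have hfd : ∀ v : ℂ, Continuous (fun z => fderiv ℝ φ z v) ∧
      HasCompactSupport (fun z => fderiv ℝ φ z v) := fun v =>
    ⟨(hφ.continuous_fderiv one_ne_zero).clm_apply continuous_const, hc.fderiv_apply (𝕜 := ℝ) v⟩
  have hi1 : ∀ (v : ℂ) (f : ℂ → ℝ), ContDiff ℝ 1 f →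
      Integrable (fun z => fderiv ℝ φ z v * f z) := fun v f hf =>
    ((hfd v).1.mul hf.continuous).integrable_of_hasCompactSupport (hfd v).2.mul_right
  have hi2 : ∀ (v : ℂ) (f : ℂ → ℝ), ContDiff ℝ 1 f →
      Integrable (fun z => φ z * fderiv ℝ f z v) := fun v f hf =>
    (hφ.continuous.mul ((hf.continuous_fderiv one_ne_zero).clm_apply
      continuous_const)).integrable_of_hasCompactSupport hc.mul_right
  have hparts : ∀ (v : ℂ) (f : ℂ → ℝ), ContDiff ℝ 1 f →
      ∫ z, φ z * fderiv ℝ f z v = -∫ z, fderiv ℝ φ z v * f z := fun v f hf =>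
    integral_mul_fderiv_eq_neg_fderiv_mul_of_integrable (hi1 v f hf) (hi2 v f hf)
      ((hφ.continuous.mul hf.continuous).integrable_of_hasCompactSupport hc.mul_right)
      (fun x _ => hφ.differentiable one_ne_zero x) (fun x _ => hf.differentiable one_ne_zero x)
  have hR : ∀ z, fderiv ℝ φ z (star (blockMean (quat z (ε : ℂ)) X 0 0))
      = fderiv ℝ φ z 1 * (blockMean (quat z (ε : ℂ)) X 0 0).re
        - fderiv ℝ φ z Complex.I * (blockMean (quat z (ε : ℂ)) X 0 0).im := by
    intro z
    generalize blockMean (quat z (ε : ℂ)) X 0 0 = w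
    have : star w = w.re • (1 : ℂ) - w.im • Complex.I := by
      apply Complex.ext <;> simp
    rw [this, map_sub, map_smul, map_smul]
    simp [mul_comm]
  simp only [hR, regDensity_eq X hε]
  rw [integral_sub (hi1 _ _ hre) (hi1 _ _ him)]
  have : ∀ z, φ z * (-(1 / (2 * Real.pi)) *
      (fderiv ℝ (fun w : ℂ => (blockMean (quat w (ε : ℂ)) X 0 0).re) z 1
        - fderiv ℝ (fun w : ℂ => (blockMean (quat w (ε : ℂ)) X 0 0).im) z Complex.I))
      = -(1 / (2 * Real.pi)) *
        (φ z * fderiv ℝ (fun w : ℂ => (blockMean (quat w (ε : ℂ)) X 0 0).re) z 1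
        - φ z * fderiv ℝ (fun w : ℂ => (blockMean (quat w (ε : ℂ)) X 0 0).im) z Complex.I) :=
    fun z => by ring
  simp only [this]
  rw [integral_const_mul, integral_sub (hi2 _ _ hre) (hi2 _ _ him), hparts _ _ hre,
    hparts _ _ him]
  ring

/-! ### Spectral density as an integral of the resolvent trace -/

section Potential

theorem integrable_clm_apply_star {α : Type*} [MeasurableSpace α] {ν : Measure α}
    {L : α → ℂ →L[ℝ] ℝ} {g : α → ℂ} {c : ℝ} (hL : AEStronglyMeasurable L ν)
    (hLc : ∀ x, ‖L x‖ ≤ c) (hg : Integrable g ν) : Integrable (fun x => L x (star (g x))) ν := by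
  refine (hg.norm.const_mul c).mono' ?_ (Filter.Eventually.of_forall fun x => ?_)
  · exact (isBoundedBilinearMap_apply (𝕜 := ℝ) (E := ℂ) (F := ℝ)).continuous.comp_aestronglyMeasurable
      (hL.prodMk (continuous_star.comp_aestronglyMeasurable hg.1))
  · refine ((L x).le_opNorm _).trans ?_
    rw [norm_star]
    exact mul_le_mul_of_nonneg_right (hLc x) (norm_nonneg _)

theorem exists_norm_fderiv_le {φ : ℂ → ℝ} (hφ : ContDiff ℝ 1 φ) (hc : HasCompactSupport φ) :
    ∃ c, ∀ z, ‖fderiv ℝ φ z‖ ≤ c :=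
  (hφ.continuous_fderiv one_ne_zero).bounded_above_of_compact_support (hc.fderiv (𝕜 := ℝ))

/-- Localising to the support gives a set of finite area when `φ` is compactly supported, as Fubini
requires. -/
theorem integral_fderiv_eq_setIntegral_tsupport {φ : ℂ → ℝ} (g : ℂ → ℂ) :
    ∫ z, fderiv ℝ φ z (g z) = ∫ z in tsupport φ, fderiv ℝ φ z (g z) := by
  refine (setIntegral_eq_integral_of_forall_compl_eq_zero fun z hz => ?_).symm
  rw [image_eq_zero_of_notMem_tsupport fun h => hz (tsupport_fderiv_subset ℝ h)]
  rfl

theorem integrable_fderiv_conj_inv_sub {φ : ℂ → ℝ} (hφ : ContDiff ℝ 1 φ)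
    (hc : HasCompactSupport φ) (μ : ℂ) :
    Integrable fun z : ℂ => fderiv ℝ φ z (star ((μ - z)⁻¹)) := by
  obtain ⟨c, hcφ⟩ := exists_norm_fderiv_le hφ hc
  rw [← integrableOn_iff_integrable_of_support_subset (s := tsupport φ)]
  · refine integrable_clm_apply_star
      (hφ.continuous_fderiv one_ne_zero).aestronglyMeasurable hcφ ⟨?_, ?_⟩
    · exact (measurable_const.sub measurable_id).inv.aestronglyMeasurable
    · refine (lintegral_inv_sub_le μ _).trans_lt (ENNReal.add_lt_top.2 ⟨?_, ENNReal.ofReal_lt_top⟩)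
      exact hc.isCompact.measure_lt_top
  · intro z hz
    by_contra h
    apply hz
    simp [image_eq_zero_of_notMem_tsupport fun h' => h (tsupport_fderiv_subset ℝ h')]

theorem integral_fderiv_conj_sum_inv_sub {φ : ℂ → ℝ} (hφ : ContDiff ℝ 1 φ)
    (hc : HasCompactSupport φ) (m : Multiset ℂ) :
    Integrable (fun z : ℂ => fderiv ℝ φ z (star ((m.map fun μ => (μ - z)⁻¹).sum))) ∧
    ∫ z : ℂ, fderiv ℝ φ z (star ((m.map fun μ => (μ - z)⁻¹).sum))
      = 2 * Real.pi * (m.map φ).sum := by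
  induction m using Multiset.induction_on with
  | empty => simp
  | cons μ m ih =>
    simp only [Multiset.map_cons, Multiset.sum_cons, star_add, map_add]
    have h := integrable_fderiv_conj_inv_sub hφ hc μ
    refine ⟨h.add ih.1, ?_⟩
    rw [integral_add h ih.1, ih.2, integral_fderiv_conj_inv_sub hφ hc]
    ring

theorem lintegral_sum_inv_sub_le (m : Multiset ℂ) (K : Set ℂ) :
    ∫⁻ z in K, ‖(m.map fun μ => (μ - z)⁻¹).sum‖ₑ
      ≤ m.card * (volume K + ENNReal.ofReal (2 * Real.pi)) := by
  induction m using Multiset.induction_on with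
  | empty => simp
  | cons μ m ih =>
    simp only [Multiset.map_cons, Multiset.sum_cons, Multiset.card_cons]
    calc _ ≤ ∫⁻ z in K, (‖(μ - z)⁻¹‖ₑ + ‖(m.map fun μ => (μ - z)⁻¹).sum‖ₑ) :=
          lintegral_mono fun z => enorm_add_le _ _
      _ = (∫⁻ z in K, ‖(μ - z)⁻¹‖ₑ) + ∫⁻ z in K, ‖(m.map fun μ => (μ - z)⁻¹).sum‖ₑ :=
          lintegral_add_left (measurable_const.sub measurable_id).inv.enorm _
      _ ≤ _ := by
          refine (add_le_add (lintegral_inv_sub_le μ K) ih).trans (le_of_eq ?_)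
          push_cast
          ring

variable {N : ℕ}

theorem ae_eval_charpoly_ne_zero (M : Matrix (Fin N) (Fin N) ℂ) :
    ∀ᵐ z : ℂ, M.charpoly.eval z ≠ 0 := by
  have h : {z : ℂ | M.charpoly.eval z = 0}.Finite :=
    M.charpoly.finite_setOfPred_isRoot M.charpoly_monic.ne_zero
  simpa [ae_iff] using h.measure_zero volume

/-- The spectral density in terms of the trace of the resolvent. -/
theorem spectralDensity_eq_integral {φ : ℂ → ℝ} (hφ : ContDiff ℝ 1 φ) (hc : HasCompactSupport φ)
    (M : Matrix (Fin N) (Fin N) ℂ) :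
    spectralDensity M φ = 1 / (2 * Real.pi) * (1 / N *
      ∫ z, fderiv ℝ φ z (star ((M - z • (1 : Matrix (Fin N) (Fin N) ℂ))⁻¹).trace)) := by
  have h : ∫ z, fderiv ℝ φ z (star ((M - z • (1 : Matrix (Fin N) (Fin N) ℂ))⁻¹).trace)
      = 2 * Real.pi * (M.charpoly.roots.map φ).sum := by
    rw [← (integral_fderiv_conj_sum_inv_sub hφ hc _).2]
    refine integral_congr_ae ?_
    filter_upwards [ae_eval_charpoly_ne_zero M] with z hz
    rw [trace_inv_sub_smul_one M hz]
  rw [h, spectralDensity]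
  have := Real.pi_ne_zero
  field_simp

/-- The bound is independent of `M`, since there are at most `N` roots and the kernel bound is
uniform in their position. -/
theorem lintegral_trace_inv_le (M : Matrix (Fin N) (Fin N) ℂ) (K : Set ℂ) :
    ∫⁻ z in K, ‖((M - z • (1 : Matrix (Fin N) (Fin N) ℂ))⁻¹).trace‖ₑ
      ≤ N * (volume K + ENNReal.ofReal (2 * Real.pi)) := by
  calc _ = ∫⁻ z in K, ‖(M.charpoly.roots.map fun μ => (μ - z)⁻¹).sum‖ₑ := by
        refine lintegral_congr_ae (ae_restrict_of_ae ?_)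
        filter_upwards [ae_eval_charpoly_ne_zero M] with z hz
        rw [trace_inv_sub_smul_one M hz]
    _ ≤ M.charpoly.roots.card * (volume K + ENNReal.ofReal (2 * Real.pi)) :=
        lintegral_sum_inv_sub_le _ _
    _ ≤ _ := by
        gcongr
        simpa using M.charpoly.card_roots'

end Potential

/-! ### Measurability of determinants and inverses -/

section Measurability

variable {α : Type*} [MeasurableSpace α] {m : Type*} [Fintype m] [DecidableEq m]

theorem measurable_matrix_det {M : α → Matrix m m ℂ} (hM : ∀ i j, Measurable fun x => M x i j) :
    Measurable fun x => (M x).det := by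
  simp only [Matrix.det_apply, Units.smul_def, zsmul_eq_mul]
  exact Finset.measurable_fun_sum _ fun σ _ =>
    measurable_const.mul (Finset.measurable_fun_prod _ fun i _ => hM _ _)

theorem measurable_matrix_inv_apply {M : α → Matrix m m ℂ}
    (hM : ∀ i j, Measurable fun x => M x i j) (i j : m) : Measurable fun x => (M x)⁻¹ i j := by
  simp only [Matrix.inv_def, Ring.inverse_eq_inv', Matrix.smul_apply, smul_eq_mul,
    Matrix.adjugate_apply]
  refine (measurable_matrix_det hM).inv.mul (measurable_matrix_det fun a b => ?_)
  by_cases h : a = j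
  · subst h
    simp
  · simpa [Matrix.updateRow_ne h] using hM a b

end Measurability

/-! ### Averaging the resolvent of the perturbed matrix -/

section Perturbation

variable {N : ℕ}

/-- The perturbed matrix `X + ε A B⁻¹`. -/
def perturbed (ε : ℝ) (X : Matrix (Fin N) (Fin N) ℂ)
    (s : (Fin N × Fin N) ⊕ (Fin N × Fin N) → ℂ) : Matrix (Fin N) (Fin N) ℂ :=
  X + (ε : ℂ) • (fstMatrix s * (sndMatrix s)⁻¹)

theorem measurable_sndMatrix (i j : Fin N) :
    Measurable fun s : (Fin N × Fin N) ⊕ (Fin N × Fin N) → ℂ => sndMatrix s i j :=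
  measurable_pi_apply _

theorem measurable_perturbed (ε : ℝ) (X : Matrix (Fin N) (Fin N) ℂ) (i j : Fin N) :
    Measurable fun s => perturbed ε X s i j := by
  simp only [perturbed, Matrix.add_apply, Matrix.smul_apply, Matrix.mul_apply, smul_eq_mul]
  refine measurable_const.add (measurable_const.mul (Finset.measurable_fun_sum _ fun k _ => ?_))
  exact (measurable_pi_apply _).mul (measurable_matrix_inv_apply measurable_sndMatrix _ _)

theorem measurable_trace_inv (ε : ℝ) (X : Matrix (Fin N) (Fin N) ℂ) :
    Measurable fun p : ((Fin N × Fin N) ⊕ (Fin N × Fin N) → ℂ) × ℂ =>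
      ((perturbed ε X p.1 - p.2 • (1 : Matrix (Fin N) (Fin N) ℂ))⁻¹).trace := by
  simp only [Matrix.trace, Matrix.diag_apply]
  refine Finset.measurable_fun_sum _ fun i _ => measurable_matrix_inv_apply (fun a b => ?_) _ _
  simp only [Matrix.sub_apply, Matrix.smul_apply, smul_eq_mul]
  exact ((measurable_perturbed ε X a b).comp measurable_fst).sub
    (measurable_snd.mul measurable_const)

/-- A complex Ginibre matrix is almost surely invertible. -/
theorem ae_isUnit_sndMatrix [IsFiniteMeasure stdComplexGaussian] :
    ∀ᵐ s ∂(Measure.pi fun _ : (Fin N × Fin N) ⊕ (Fin N × Fin N) => stdComplexGaussian),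
      IsUnit (sndMatrix s).det := by
  rw [pi_stdComplexGaussian]
  refine (withDensity_absolutelyContinuous _ _).ae_le ?_
  change ∀ᵐ s, IsUnit (sndMatrix s).det
  -- Along the direction `(0, 1)` the determinant `det (B + t)` is the characteristic polynomial of
  -- `-B` at `t`, so each line meets the singular set in finitely many points.
  let w : (Fin N × Fin N) ⊕ (Fin N × Fin N) → ℂ := entries 0 1
  let f : ((Fin N × Fin N) ⊕ (Fin N × Fin N) → ℂ) × ℝ → ℂ :=
    fun p => (sndMatrix (p.1 + p.2 • w)).det
  have hf : Measurable f := by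
    refine measurable_matrix_det fun i j => ?_
    have : Measurable fun p : ((Fin N × Fin N) ⊕ (Fin N × Fin N) → ℂ) × ℝ => p.1 + p.2 • w :=
      measurable_fst.add (measurable_snd.smul_const w)
    exact (measurable_sndMatrix i j).comp this
  have hset : MeasurableSet {p | f p = 0} := hf (measurableSet_singleton 0)
  have hline : ∀ s, (volume : Measure ℝ) (Prod.mk s ⁻¹' {p | f p = 0}) = 0 := by
    intro s
    have hfin : {z : ℂ | (-sndMatrix s).charpoly.eval z = 0}.Finite :=
      (-sndMatrix s).charpoly.finite_setOfPred_isRoot (-sndMatrix s).charpoly_monic.ne_zero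
    refine Set.Finite.measure_zero ?_ _
    refine (hfin.preimage Complex.ofReal_injective.injOn).subset fun t ht => ?_
    have ht : f (s, t) = 0 := ht
    change (-sndMatrix s).charpoly.eval (t : ℂ) = 0
    rw [Matrix.eval_charpoly, ← ht]
    congr 1
    ext i j
    change Matrix.scalar (Fin N) (t : ℂ) i j - -(s (.inr (i, j)))
      = s (.inr (i, j)) + t • (1 : Matrix (Fin N) (Fin N) ℂ) i j
    by_cases h : i = j <;> simp [h, Matrix.one_apply, add_comm]
  have hnull : ((volume : Measure ((Fin N × Fin N) ⊕ (Fin N × Fin N) → ℂ)).prod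
      (volume : Measure ℝ)) {p | f p = 0} = 0 := by
    rw [Measure.measure_prod_null hset]
    exact Filter.Eventually.of_forall hline
  have hswap : ((volume : Measure ℝ).prod
      (volume : Measure ((Fin N × Fin N) ⊕ (Fin N × Fin N) → ℂ)))
      (Prod.swap ⁻¹' {p | f p = 0}) = 0 := by
    rw [← Measure.map_apply measurable_swap hset, Measure.prod_swap, hnull]
  -- Fubini in the other order yields one `t` with `B + t` invertible for almost every `B`;
  -- translation invariance of Lebesgue measure then removes `t`.
  obtain ⟨t, ht⟩ := (Measure.ae_ae_of_ae_prod (p := fun q : ℝ × _ => ¬ f q.swap = 0)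
    (by rw [ae_iff]; simpa using hswap)).exists
  have h2 := (eventually_add_right_iff (volume) (-(t • w)) (p := fun s =>
    IsUnit (sndMatrix (s + t • w)).det)).2 (ht.mono fun s hs => isUnit_iff_ne_zero.2 hs)
  simpa using h2

theorem pencil_mul_inv {ε : ℝ} {X : Matrix (Fin N) (Fin N) ℂ} {z : ℂ}
    {s : (Fin N × Fin N) ⊕ (Fin N × Fin N) → ℂ} (hB : IsUnit (sndMatrix s).det) :
    perturbed ε X s - z • (1 : Matrix (Fin N) (Fin N) ℂ)
      = pencil ε (X - z • 1) s * (sndMatrix s)⁻¹ := by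
  rw [pencil, add_mul, mul_assoc, Matrix.mul_nonsing_inv _ hB, mul_one, perturbed, smul_mul_assoc]
  abel

/-- Once the pencil is held fixed, the trace is linear in `B`, which is what the reflection
exploits. -/
theorem trace_inv_perturbed {ε : ℝ} {X : Matrix (Fin N) (Fin N) ℂ} {z : ℂ}
    {s : (Fin N × Fin N) ⊕ (Fin N × Fin N) → ℂ} (hB : IsUnit (sndMatrix s).det) :
    ((perturbed ε X s - z • (1 : Matrix (Fin N) (Fin N) ℂ))⁻¹).trace
      = (sndMatrix s * (pencil ε (X - z • 1) s)⁻¹).trace := by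
  rw [pencil_mul_inv hB, Matrix.mul_inv_rev, Matrix.nonsing_inv_nonsing_inv _ hB]

theorem isUnit_det_pencil {ε : ℝ} {X : Matrix (Fin N) (Fin N) ℂ} {z : ℂ}
    {s : (Fin N × Fin N) ⊕ (Fin N × Fin N) → ℂ} (hB : IsUnit (sndMatrix s).det)
    (hz : (perturbed ε X s).charpoly.eval z ≠ 0) : IsUnit (pencil ε (X - z • 1) s).det := by
  rw [isUnit_iff_ne_zero]
  intro h
  apply hz
  have h1 : (perturbed ε X s - z • (1 : Matrix (Fin N) (Fin N) ℂ)).det = 0 := by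
    rw [pencil_mul_inv hB, Matrix.det_mul, h, zero_mul]
  have h2 : Matrix.scalar (Fin N) z - perturbed ε X s
      = -(perturbed ε X s - z • (1 : Matrix (Fin N) (Fin N) ℂ)) := by
    rw [neg_sub]
    congr 1
    ext i j
    by_cases h : i = j <;> simp [h]
  rw [Matrix.eval_charpoly, h2, Matrix.det_neg, h1, mul_zero]

/-- Averaging over the reflection that fixes the pencil yields the mean resolvent trace. -/
theorem integral_trace_inv_perturbed [IsProbabilityMeasure stdComplexGaussian] {ε : ℝ}
    (hε : ε ≠ 0) (X : Matrix (Fin N) (Fin N) ℂ) (z : ℂ)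
    (hz : ∀ᵐ s ∂(Measure.pi fun _ : (Fin N × Fin N) ⊕ (Fin N × Fin N) => stdComplexGaussian),
      (perturbed ε X s).charpoly.eval z ≠ 0)
    (hint : Integrable
      (fun s => ((perturbed ε X s - z • (1 : Matrix (Fin N) (Fin N) ℂ))⁻¹).trace)
      (Measure.pi fun _ : (Fin N × Fin N) ⊕ (Fin N × Fin N) => stdComplexGaussian)) :
    ∫ s, ((perturbed ε X s - z • (1 : Matrix (Fin N) (Fin N) ℂ))⁻¹).trace
        ∂(Measure.pi fun _ : (Fin N × Fin N) ⊕ (Fin N × Fin N) => stdComplexGaussian)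
      = ((X - z • (1 : Matrix (Fin N) (Fin N) ℂ))ᴴ * (regCov ε (X - z • 1))⁻¹).trace := by
  set γ := Measure.pi fun _ : (Fin N × Fin N) ⊕ (Fin N × Fin N) => stdComplexGaussian with hγ
  set Y := X - z • (1 : Matrix (Fin N) (Fin N) ℂ) with hY
  set g := fun s => ((perturbed ε X s - z • (1 : Matrix (Fin N) (Fin N) ℂ))⁻¹).trace with hg
  have hmp : MeasurePreserving (reflect ε Y) γ γ := measurePreserving_reflect hε Y
  -- The pencil `C` is common to both terms and the two second components add up to `2 Yᴴ (Y Yᴴ +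
  -- ε²)⁻¹ C`, so `C` cancels against its inverse.
  have hsum : ∀ᵐ s ∂γ, g s + g (reflect ε Y s) = 2 * (Yᴴ * (regCov ε Y)⁻¹).trace := by
    filter_upwards [ae_isUnit_sndMatrix, hmp.quasiMeasurePreserving.ae ae_isUnit_sndMatrix, hz]
      with s h1 h2 h3
    have hC := isUnit_det_pencil h1 h3
    rw [hg]
    simp only
    rw [trace_inv_perturbed h1, trace_inv_perturbed h2, pencil_reflect hε, sndMatrix_reflect,
      ← Matrix.trace_add, ← add_mul, add_sub_cancel, smul_mul_assoc, mul_assoc,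
      Matrix.mul_nonsing_inv _ hC, mul_one, Matrix.trace_smul, smul_eq_mul]
  have hint2 : Integrable (fun s => g (reflect ε Y s)) γ := hmp.integrable_comp_of_integrable hint
  have heq : ∫ s, g (reflect ε Y s) ∂γ = ∫ s, g s ∂γ := by
    conv_rhs => rw [← hmp.map_eq]
    rw [integral_map hmp.aemeasurable]
    rw [hmp.map_eq]
    exact hint.1
  have h := integral_congr_ae hsum
  rw [integral_add hint hint2, heq, integral_const, probReal_univ, one_smul, ← two_mul] at h
  exact mul_left_cancel₀ two_ne_zero h

theorem integrable_trace_inv_perturbed [IsProbabilityMeasure stdComplexGaussian] (ε : ℝ)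
    (X : Matrix (Fin N) (Fin N) ℂ) {K : Set ℂ} (hK : volume K ≠ ⊤) :
    Integrable (fun p : ((Fin N × Fin N) ⊕ (Fin N × Fin N) → ℂ) × ℂ =>
      ((perturbed ε X p.1 - p.2 • (1 : Matrix (Fin N) (Fin N) ℂ))⁻¹).trace)
      ((Measure.pi fun _ => stdComplexGaussian).prod (volume.restrict K)) := by
  refine ⟨(measurable_trace_inv ε X).aestronglyMeasurable, ?_⟩
  rw [HasFiniteIntegral, lintegral_prod _ (measurable_trace_inv ε X).enorm.aemeasurable]
  refine (lintegral_mono fun s => lintegral_trace_inv_le (perturbed ε X s) K).trans_lt ?_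
  rw [lintegral_const, measure_univ, mul_one]
  exact ENNReal.mul_lt_top (ENNReal.natCast_lt_top N)
    (ENNReal.add_lt_top.2 ⟨hK.lt_top, ENNReal.ofReal_lt_top⟩)

/-- Both requirements at fixed `z` come from Fubini: each matrix has finitely many eigenvalues,
hence almost every `z` is almost surely not one; and joint integrability passes to almost every
slice. -/
theorem ae_integral_trace_inv_perturbed [IsProbabilityMeasure stdComplexGaussian] {ε : ℝ}
    (hε : ε ≠ 0) (X : Matrix (Fin N) (Fin N) ℂ) {K : Set ℂ} (hK : volume K ≠ ⊤) :
    ∀ᵐ z ∂(volume.restrict K), Integrable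
      (fun s => ((perturbed ε X s - z • (1 : Matrix (Fin N) (Fin N) ℂ))⁻¹).trace)
        (Measure.pi fun _ : (Fin N × Fin N) ⊕ (Fin N × Fin N) => stdComplexGaussian) ∧
      ∫ s, ((perturbed ε X s - z • (1 : Matrix (Fin N) (Fin N) ℂ))⁻¹).trace
        ∂(Measure.pi fun _ : (Fin N × Fin N) ⊕ (Fin N × Fin N) => stdComplexGaussian)
      = ((X - z • (1 : Matrix (Fin N) (Fin N) ℂ))ᴴ * (regCov ε (X - z • 1))⁻¹).trace := by
  have hmeas : Measurable fun p : ((Fin N × Fin N) ⊕ (Fin N × Fin N) → ℂ) × ℂ =>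
      (perturbed ε X p.1).charpoly.eval p.2 := by
    simp only [Matrix.eval_charpoly]
    refine measurable_matrix_det fun i j => ?_
    simp only [Matrix.sub_apply, Matrix.scalar_apply, Matrix.diagonal_apply]
    refine Measurable.sub ?_ ((measurable_perturbed ε X i j).comp measurable_fst)
    split_ifs
    · exact measurable_snd
    · exact measurable_const
  have hroot : ∀ᵐ z ∂(volume.restrict K),
      ∀ᵐ s ∂(Measure.pi fun _ : (Fin N × Fin N) ⊕ (Fin N × Fin N) => stdComplexGaussian),
        (perturbed ε X s).charpoly.eval z ≠ 0 := by
    refine (Measure.ae_ae_comm ?_).1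
      (Filter.Eventually.of_forall fun s => ae_restrict_of_ae (ae_eval_charpoly_ne_zero _))
    exact (hmeas (measurableSet_singleton 0)).compl
  filter_upwards [hroot, (integrable_trace_inv_perturbed ε X hK).prod_left_ae] with z h1 h2
  exact ⟨h2, integral_trace_inv_perturbed hε X z h1 h2⟩

/-- The perturbation formula on the Gaussian space of pairs of matrices. -/
theorem integral_spectralDensity_perturbed [IsProbabilityMeasure stdComplexGaussian] {ε : ℝ}
    (hε : ε ≠ 0) (X : Matrix (Fin N) (Fin N) ℂ) {φ : ℂ → ℝ} (hφ : ContDiff ℝ 1 φ)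
    (hc : HasCompactSupport φ) :
    Integrable (fun s => spectralDensity (perturbed ε X s) φ)
      (Measure.pi fun _ => stdComplexGaussian) ∧
    ∫ s, spectralDensity (perturbed ε X s) φ ∂(Measure.pi fun _ => stdComplexGaussian)
      = ∫ z, φ z * regDensity ε X z := by
  set γ := Measure.pi fun _ : (Fin N × Fin N) ⊕ (Fin N × Fin N) => stdComplexGaussian with hγ
  have hK : volume (tsupport φ) ≠ ⊤ := hc.isCompact.measure_lt_top.ne
  obtain ⟨c, hcφ⟩ := exists_norm_fderiv_le hφ hc
  have hF : Integrable (fun p : ((Fin N × Fin N) ⊕ (Fin N × Fin N) → ℂ) × ℂ =>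
      fderiv ℝ φ p.2 (star ((perturbed ε X p.1 - p.2 • (1 : Matrix (Fin N) (Fin N) ℂ))⁻¹).trace))
      (γ.prod (volume.restrict (tsupport φ))) :=
    integrable_clm_apply_star
      ((hφ.continuous_fderiv one_ne_zero).comp continuous_snd).aestronglyMeasurable
      (fun p => hcφ p.2) (integrable_trace_inv_perturbed ε X hK)
  -- Written as an integral over `z`, the spectral density inherits measurability and integrability
  -- in `s` from Fubini, with no measurable choice of eigenvalues.
  simp only [spectralDensity_eq_integral hφ hc, integral_fderiv_eq_setIntegral_tsupport]
  refine ⟨(hF.integral_prod_left.const_mul _).const_mul _, ?_⟩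
  rw [integral_const_mul, integral_const_mul, integral_integral_swap hF,
    integral_mul_regDensity X hε hφ hc, integral_fderiv_eq_setIntegral_tsupport,
    ← integral_const_mul (1 / (N : ℝ))]
  congr 1
  refine integral_congr_ae ?_
  filter_upwards [ae_integral_trace_inv_perturbed hε X hK] with z hz
  -- The map `w ↦ dφ_z(conj w)` is real-linear and continuous, so it commutes with the expectation.
  have hcomm := ((fderiv ℝ φ z).comp (Complex.conjCLE : ℂ →L[ℝ] ℂ)).integral_comp_comm hz.1
  rw [hz.2] at hcomm
  refine (congrArg (1 / (N : ℝ) * ·) hcomm).trans ?_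
  have hs : ∀ w : ℂ, star (1 / (N : ℂ) * w) = (1 / (N : ℝ)) • star w := by
    intro w
    rw [star_mul', Complex.real_smul]
    simp
  rw [blockMean_zero_zero X hε, hs, map_smul]
  rfl

end Perturbation

end QuatGreen

end

/-! ### Transfer to the given probability space -/

theorem theorem1 {Ω : Type*} [MeasurableSpace Ω] (P : Measure Ω) [IsProbabilityMeasure P]
    {N : ℕ} (hN : 0 < N) (X : Matrix (Fin N) (Fin N) ℂ) (ε : ℝ) (hε : 0 < ε)
    (A B : Ω → Matrix (Fin N) (Fin N) ℂ)
    (hA : ∀ i j, HasLaw (fun η => A η i j) QuatGreen.stdComplexGaussian P)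
    (hB : ∀ i j, HasLaw (fun η => B η i j) QuatGreen.stdComplexGaussian P)
    (hAB : iIndepFun
      (fun (k : (Fin N × Fin N) ⊕ (Fin N × Fin N)) (η : Ω) =>
        Sum.elim (fun p => A η p.1 p.2) (fun p => B η p.1 p.2) k) P) :
    (∀ᵐ η ∂P, IsUnit (B η)) ∧
    ContDiff ℝ 1 (fun z : ℂ => QuatGreen.green (QuatGreen.quat z (ε : ℂ)) X) ∧
    ∀ φ : ℂ → ℝ, ContDiff ℝ ∞ φ → HasCompactSupport φ →
      Integrable
        (fun η => QuatGreen.spectralDensity (X + (ε : ℂ) • (A η * (B η)⁻¹)) φ) P ∧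
      ∫ η, QuatGreen.spectralDensity (X + (ε : ℂ) • (A η * (B η)⁻¹)) φ ∂P =
        ∫ z : ℂ, φ z * QuatGreen.regDensity ε X z := by
  -- The Gaussian has total mass one because it is the law of an entry, which exists as `N > 0`.
  have hprob : IsProbabilityMeasure QuatGreen.stdComplexGaussian := by
    rw [← (hA ⟨0, hN⟩ ⟨0, hN⟩).map_eq]
    exact Measure.isProbabilityMeasure_map (hA _ _).aemeasurable
  have hlaw : ∀ k : (Fin N × Fin N) ⊕ (Fin N × Fin N),
      HasLaw (fun η => Sum.elim (fun p => A η p.1 p.2) (fun p => B η p.1 p.2) k)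
        QuatGreen.stdComplexGaussian P := by
    rintro (p | p)
    · exact hA p.1 p.2
    · exact hB p.1 p.2
  have hS : AEMeasurable (fun η => QuatGreen.entries (A η) (B η)) P :=
    aemeasurable_pi_lambda _ fun k => (hlaw k).aemeasurable
  -- Independence makes the joint law of all entries the product measure.
  have hmap : P.map (fun η => QuatGreen.entries (A η) (B η))
      = Measure.pi fun _ => QuatGreen.stdComplexGaussian := by
    have := hAB.map_fun_eq_pi_map fun k => (hlaw k).aemeasurable
    simp only [fun k => (hlaw k).map_eq] at this
    exact this
  refine ⟨?_, QuatGreen.contDiff_green X hε.ne', fun φ hφ hc => ?_⟩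
  · have h := QuatGreen.ae_isUnit_sndMatrix (N := N)
    rw [← hmap] at h
    filter_upwards [ae_of_ae_map hS h] with η hη
    exact (Matrix.isUnit_iff_isUnit_det _).2 hη
  · obtain ⟨h1, h2⟩ := QuatGreen.integral_spectralDensity_perturbed hε.ne' X
      (hφ.of_le (by exact_mod_cast le_top)) hc
    rw [← hmap] at h1 h2
    refine ⟨h1.comp_aemeasurable hS, ?_⟩
    rw [integral_map hS h1.1] at h2
    exact h2
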